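/- Let $p$ be a prime number and let $R$ be a commutative noetherian ring of characteristic $p$ that is $F$-finite, i.e. the Frobenius endomorphism $F\colon R\to R$, $x\mapsto x^p$, is module-finite. For a commutative ring $S$ of characteristic $p$ and $e\ge 0$ let $F^e_*S$ be the $S$-module obtained from $S$ by restriction of scalars along $F^e$. A complete local $F$-finite ring $S$ has \emph{finite $F$-representation type} (FFRT) if there are finitely many finitely generated indecomposable $S$-modules $M_1,\dots,M_s$ such that for every $e\ge 0$ there are integers $n_{1,e},\dots,n_{s,e}\ge 0$ with $F^e_*S\cong M_1^{\oplus n_{1,e}}\oplus\cdots\oplus M_s^{\oplus n_{s,e}}$ as $S$-modules. Suppose that $R$ has \emph{complete local finite $F$-representation type} (CL-FFRT), i.e. for every prime ideal $\mathfrak p\subseteq R$ the completion $\widehat{R_{\mathfrak p}}$ of the local ring $R_{\mathfrak p}$ has FFRT. Let $g\in R$ be a nonzerodivisor, let $I\subseteq R$ be an ideal, and let $i\ge 0$ be an integer. Then the support $$\operatorname{Supp}_R H^i_I(R/gR)=\{\mathfrak p\in\operatorname{Spec} R : H^i_I(R/gR)_{\mathfrak p}\neq 0\}$$ of the local cohomology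 module $H^i_I(R/gR)$ is a closed subset of $\operatorname{Spec} R$ in the Zariski topology. -/

import Mathlib

open CategoryTheory

universe u

/-- A noetherian ring `R` of prime characteristic `p` is `F`-finite if its Frobenius endomorphism
is module-finite. -/
structure IsFFinite (p : ℕ) [Fact p.Prime] (R : Type u) [CommRing R] [CharP R p] : Prop where
  isNoetherianRing : IsNoetherianRing R
  finite_frobenius : (frobenius R p).Finite

/-- The `S`-module `F^e_* S`: the abelian group `S`, on which `x : S` acts as multiplication
by `x ^ p ^ e`. -/
noncomputable abbrev frobeniusPushforward (p : ℕ) [Fact p.Prime] (S : Type u) [CommRing S]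
    [CharP S p] (e : ℕ) : ModuleCat.{u} S :=
  (ModuleCat.restrictScalars (iterateFrobenius S p e)).obj (ModuleCat.of S S)

/-- Finite `F`-representation type, a notion for complete local `F`-finite rings `S`: there are
finitely many finitely generated indecomposable `S`-modules `M₁, …, Mₛ` such that every `F^e_* S`
is isomorphic to a finite direct sum of copies of these. -/
def HasFFRT (p : ℕ) [Fact p.Prime] (S : Type u) [CommRing S] [CharP S p] : Prop :=
  ∃ (s : ℕ) (M : Fin s → ModuleCat.{u} S),
    (∀ j, Module.Finite S (M j) ∧ Indecomposable (M j)) ∧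
    ∀ e : ℕ, ∃ n : Fin s → ℕ,
      Nonempty (frobeniusPushforward p S e ≃ₗ[S] ((j : Fin s) → (Fin (n j) → M j)))

/-- The completion of the local ring `R_P` at its maximal ideal. -/
abbrev CompletedLocalRing {R : Type u} [CommRing R] (P : Ideal R) [P.IsPrime] : Type u :=
  AdicCompletion (IsLocalRing.maximalIdeal (Localization.AtPrime P)) (Localization.AtPrime P)

instance CompletedLocalRing.nontrivial {R : Type u} [CommRing R] (P : Ideal R) [P.IsPrime] :
    Nontrivial (CompletedLocalRing P) := by
  have h : Function.Surjective
      (AdicCompletion.evalₐ (IsLocalRing.maximalIdeal (Localization.AtPrime P)) 1) :=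
    AdicCompletion.surjective_evalₐ _ 1
  have : Nontrivial (Localization.AtPrime P ⧸
      IsLocalRing.maximalIdeal (Localization.AtPrime P) ^ 1) := by
    rw [pow_one]
    exact Ideal.Quotient.nontrivial_iff.2 (IsLocalRing.maximalIdeal.isMaximal _).ne_top
  exact h.nontrivial

instance CompletedLocalRing.charP (p : ℕ) [Fact p.Prime] {R : Type u} [CommRing R] [CharP R p]
    (P : Ideal R) [P.IsPrime] : CharP (CompletedLocalRing P) p := by
  refine (CharP.charP_iff_prime_eq_zero Fact.out).2 ?_
  have h : algebraMap R (CompletedLocalRing P) (p : R) = 0 := by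
    rw [CharP.cast_eq_zero, map_zero]
  rwa [map_natCast] at h

/-- Complete local finite `F`-representation type: `R` is `F`-finite, and for every prime ideal
`P` the completion of the local ring `R_P` has finite `F`-representation type. -/
structure HasCLFFRT (p : ℕ) [Fact p.Prime] (R : Type u) [CommRing R] [CharP R p] : Prop where
  isFFinite : IsFFinite p R
  hasFFRT : ∀ (P : Ideal R) [P.IsPrime], HasFFRT p (CompletedLocalRing P)

/-!
Write `F^e_* R` for `R` regarded as a module over itself through `x ↦ x ^ p ^ e`, and let `I` be
generated by a finite family `f`. Local cohomology is computed by the Čech complex of `f`, at least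
as far as supports are concerned (`Cech.vanishExt_iff_vanish`). By the long exact sequence of
`0 → R → R → R / g R → 0` (`Cech.vanish_iff_of_exact`), a prime `P` lies outside of the support of
`H^i_I(R / g R)` if and only if, after localization at `P`, multiplication by `g` is surjective on
`H^i_I(R)` and injective on `H^(i+1)_I(R)`.

Neither condition is visibly open, because these local cohomology modules need not be finitely
generated. The cochains on `R` whose denominators are powers `f i ^ n` with a fixed `n` do form
finitely generated modules, and the Čech complex of `F^e_* R` is that of `R` with the scalars
restricted along Frobenius (`Cech.theta`); cochains on `R` with denominators `f i ^ p ^ e` become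
cochains on `F^e_* R` with denominators `f i`. Since surjectivity and injectivity of `g` are
equivalent to surjectivity and injectivity of `g ^ p ^ e`, the two conditions say that for all `e`
cocycles on `F^e_* R` with denominators `f i` are, after localization at `P`, divisible by `g`
modulo coboundaries, respectively are coboundaries if their multiples by `g` are. For each single
`e` this is a condition on a finitely generated module, hence open in `P`
(`PrimeSpectrum.isOpen_forall_exists_smul_mem`).

Finite `F`-representation type reduces all `e` to finitely many. There is an `n` such that every
`F^e_* R` is a direct summand of a finite direct sum of modules `F^b_* R` with `b ≤ n`
(`HasCLFFRT.exists_id_mem_traceEnd`), and the conditions pass to direct sums and direct summands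
(`Cech.exists_smul_mem_of_traceEnd`); so only the conditions for `e ≤ n` matter, and the complement
of the support is a finite intersection of open sets.

Over the completed local rings the existence of `n` is immediate from the definition. It descends
to a neighbourhood of each prime of `R`, since being such a direct summand descends along flat maps
(`exists_smul_id_mem_traceEnd_of_flat`) and `F^e_*` commutes with localization and with completion
(`FrobeniusPushforward.nonempty_equiv_of_isLocalization`,
`FrobeniusPushforward.adicCompletionEquiv`). The scalars `r` such that `r` times the identity of
`F^(n+1)_* R` factors through a finite direct sum of modules `F^b_* R` with `b ≤ n` form an ideal,
which grows with `n` because `F_*` is a functor. One of these ideals is the unit ideal, as `R` is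
noetherian (`exists_forall_id_mem_traceEnd`).
-/

/-! ### The Čech complex -/

namespace Cech

section Basic

variable {R : Type u} [CommRing R] {ι : Type} (f : ι → R)

/-- The localization of `M` away from `a`, as an object of `ModuleCat R`. -/
noncomputable abbrev away (a : R) (M : ModuleCat.{u} R) : ModuleCat.{u} R :=
  ModuleCat.of R (LocalizedModule (Submonoid.powers a) M)

/-- The localization map `M → M_a`. -/
noncomputable abbrev toAway (a : R) (M : ModuleCat.{u} R) : M →ₗ[R] away a M :=
  LocalizedModule.mkLinearMap (Submonoid.powers a) M

/-- The map `M_a → N_a` induced by a linear map `M → N`. -/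
noncomputable def awayMap (a : R) {M N : ModuleCat.{u} R} :
    (M →ₗ[R] N) →ₗ[R] (away a M →ₗ[R] away a N) :=
  IsLocalizedModule.map (Submonoid.powers a) (toAway a M) (toAway a N)

/-- The modules of cochains of the full Čech complex of a family `f : ι → R`, augmented by `M` in
degree zero. They are defined by recursion on the degree: a cochain of degree `k + 1` with
coefficients in `M` is a family, indexed by `i : ι`, of cochains of degree `k` with coefficients
in the localization of `M` away from `f i`. -/
noncomputable def cochain : ℕ → ModuleCat.{u} R → ModuleCat.{u} R
  | 0, M => M
  | k + 1, M => ModuleCat.of R (∀ i, cochain k (away (f i) M))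

/-- The map induced by a linear map of coefficients on Čech cochains. -/
noncomputable def map : (k : ℕ) → {M N : ModuleCat.{u} R} →
    (M →ₗ[R] N) →ₗ[R] (cochain f k M →ₗ[R] cochain f k N)
  | 0, _, _ => LinearMap.id
  | k + 1, _, _ =>
    { toFun := fun φ => (LinearMap.pi fun i => (map k (awayMap (f i) φ)) ∘ₗ LinearMap.proj i :
        (∀ i, cochain f k (away (f i) _)) →ₗ[R] (∀ i, cochain f k (away (f i) _)))
      map_add' := fun φ ψ => by
        refine LinearMap.ext fun c => funext fun i => ?_
        change map k (awayMap (f i) (φ + ψ)) (c i) =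
          map k (awayMap (f i) φ) (c i) + map k (awayMap (f i) ψ) (c i)
        rw [map_add, map_add, LinearMap.add_apply]
      map_smul' := fun r φ => by
        refine LinearMap.ext fun c => funext fun i => ?_
        change map k (awayMap (f i) (r • φ)) (c i) = r • map k (awayMap (f i) φ) (c i)
        rw [map_smul, map_smul, LinearMap.smul_apply] }

/-- The differential of the Čech complex. In terms of the recursive definition of cochains, the
component at `i` of `d c` is the difference of the localization of `c` away from `f i` and of
the differential of the component of `c` at `i`. -/
noncomputable def d : (k : ℕ) → (M : ModuleCat.{u} R) →
    (cochain f k M →ₗ[R] cochain f (k + 1) M)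
  | 0, M => (LinearMap.pi fun i => toAway (f i) M : M →ₗ[R] (∀ i, away (f i) M))
  | k + 1, M => (LinearMap.pi fun i => map f (k + 1) (toAway (f i) M) -
      d k (away (f i) M) ∘ₗ LinearMap.proj i :
      cochain f (k + 1) M →ₗ[R] (∀ i, cochain f (k + 1) (away (f i) M)))

variable {f}

variable {M N Q : ModuleCat.{u} R}

/-- The component at `i` of a cochain of positive degree. -/
noncomputable def comp (k : ℕ) (M : ModuleCat.{u} R) (i : ι) :
    cochain f (k + 1) M →ₗ[R] cochain f k (away (f i) M) :=
  (LinearMap.proj i : (∀ i, cochain f k (away (f i) M)) →ₗ[R] cochain f k (away (f i) M))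

lemma ext_comp {k : ℕ} {c c' : cochain f (k + 1) M} (h : ∀ i, comp k M i c = comp k M i c') :
    c = c' := funext h

/-- A cochain of positive degree with given components. -/
noncomputable def ofComp (k : ℕ) (M : ModuleCat.{u} R)
    (c : ∀ i, cochain f k (away (f i) M)) : cochain f (k + 1) M := c

@[simp] lemma comp_ofComp (k : ℕ) (c : ∀ i, cochain f k (away (f i) M)) (i : ι) :
    comp k M i (ofComp k M c) = c i := rfl

@[simp] lemma comp_map (k : ℕ) (φ : M →ₗ[R] N) (i : ι) (c : cochain f (k + 1) M) :
    comp k N i (map f (k + 1) φ c) = map f k (awayMap (f i) φ) (comp k M i c) := rfl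

@[simp] lemma map_zero_apply (φ : M →ₗ[R] N) (c : cochain f 0 M) : map f 0 φ c = φ c := rfl

@[simp] lemma comp_d_zero (i : ι) (c : cochain f 0 M) :
    comp 0 M i (d f 0 M c) = toAway (f i) M c := rfl

@[simp] lemma comp_d_succ (k : ℕ) (i : ι) (c : cochain f (k + 1) M) :
    comp (k + 1) M i (d f (k + 1) M c) =
      map f (k + 1) (toAway (f i) M) c - d f k (away (f i) M) (comp k M i c) := rfl

lemma awayMap_toAway (a : R) (φ : M →ₗ[R] N) :
    awayMap a φ ∘ₗ toAway a M = toAway a N ∘ₗ φ := IsLocalizedModule.map_comp _ _ _ _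

lemma awayMap_id (a : R) : awayMap a (LinearMap.id : M →ₗ[R] M) = LinearMap.id :=
  IsLocalizedModule.map_id _ _

lemma awayMap_comp (a : R) (φ : M →ₗ[R] N) (ψ : N →ₗ[R] Q) :
    awayMap a (ψ ∘ₗ φ) = awayMap a ψ ∘ₗ awayMap a φ :=
  IsLocalizedModule.map_comp' _ _ _ _ _ _

lemma map_id (k : ℕ) : ∀ M : ModuleCat.{u} R, map f k (LinearMap.id : M →ₗ[R] M) = LinearMap.id := by
  induction k with
  | zero => intro M; rfl
  | succ k ih =>
    intro M
    refine LinearMap.ext fun c => ext_comp fun i => ?_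
    rw [comp_map, awayMap_id, ih]; rfl

lemma map_comp (k : ℕ) : ∀ {M N Q : ModuleCat.{u} R} (φ : M →ₗ[R] N) (ψ : N →ₗ[R] Q),
    map f k (ψ ∘ₗ φ) = map f k ψ ∘ₗ map f k φ := by
  induction k with
  | zero => intros; rfl
  | succ k ih =>
    intro M N Q φ ψ
    refine LinearMap.ext fun c => ext_comp fun i => ?_
    rw [comp_map, awayMap_comp, ih, LinearMap.comp_apply, LinearMap.comp_apply, comp_map, comp_map]

lemma map_map (k : ℕ) (φ : M →ₗ[R] N) (ψ : N →ₗ[R] Q) (c : cochain f k M) :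
    map f k ψ (map f k φ c) = map f k (ψ ∘ₗ φ) c := by
  rw [map_comp]; rfl

lemma map_d (k : ℕ) : ∀ {M N : ModuleCat.{u} R} (φ : M →ₗ[R] N) (c : cochain f k M),
    map f (k + 1) φ (d f k M c) = d f k N (map f k φ c) := by
  induction k with
  | zero =>
    intro M N φ c
    refine ext_comp fun i => ?_
    rw [comp_map, comp_d_zero, comp_d_zero]
    exact LinearMap.congr_fun (awayMap_toAway (f i) φ) c
  | succ k ih =>
    intro M N φ c
    refine ext_comp fun i => ?_
    rw [comp_map, comp_d_succ, comp_d_succ, map_sub, ih, comp_map, map_map, map_map,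
      awayMap_toAway]

lemma d_d (k : ℕ) : ∀ (M : ModuleCat.{u} R) (c : cochain f k M),
    d f (k + 1) M (d f k M c) = 0 := by
  induction k with
  | zero =>
    intro M c
    refine ext_comp fun i => ?_
    rw [comp_d_succ, map_d, comp_d_zero, map_zero_apply, sub_self, map_zero]
  | succ k ih =>
    intro M c
    refine ext_comp fun i => ?_
    rw [comp_d_succ, map_d, comp_d_succ, map_sub, ih, sub_zero, sub_self, map_zero]

lemma map_injective (k : ℕ) : ∀ {M N : ModuleCat.{u} R} (φ : M →ₗ[R] N),
    Function.Injective φ → Function.Injective (map f k φ) := by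
  induction k with
  | zero => intro M N φ h; exact h
  | succ k ih =>
    intro M N φ h c c' hc
    refine ext_comp fun i => ih _ (IsLocalizedModule.map_injective (.powers (f i))
      (toAway (f i) M) (toAway (f i) N) φ h) ?_
    exact congrArg (comp k N i) hc

lemma map_surjective (k : ℕ) : ∀ {M N : ModuleCat.{u} R} (φ : M →ₗ[R] N),
    Function.Surjective φ → Function.Surjective (map f k φ) := by
  induction k with
  | zero => intro M N φ h; exact h
  | succ k ih =>
    intro M N φ h c
    choose b hb using fun i => ih _ (IsLocalizedModule.map_surjective (.powers (f i))
      (toAway (f i) M) (toAway (f i) N) φ h) (comp k N i c)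
    exact ⟨ofComp k M b, ext_comp hb⟩

lemma map_exact (k : ℕ) : ∀ {M N Q : ModuleCat.{u} R} (φ : M →ₗ[R] N) (ψ : N →ₗ[R] Q),
    Function.Exact φ ψ → Function.Exact (map f k φ) (map f k ψ) := by
  induction k with
  | zero => intro M N Q φ ψ h; exact h
  | succ k ih =>
    intro M N Q φ ψ h c
    have hi := fun i => ih _ _ (IsLocalizedModule.map_exact (.powers (f i))
      (toAway (f i) M) (toAway (f i) N) (toAway (f i) Q) φ ψ h) (comp k N i c)
    constructor
    · intro hc
      choose b hb using fun i => (hi i).1 (by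
        have := congrArg (comp k Q i) hc
        rwa [comp_map, map_zero] at this)
      exact ⟨ofComp k M b, ext_comp hb⟩
    · rintro ⟨b, rfl⟩
      refine ext_comp fun i => ?_
      rw [map_zero]
      exact (hi i).2 ⟨comp k M i b, rfl⟩

/-- The cocycles of the Čech complex. -/
noncomputable def cocycles (f : ι → R) (k : ℕ) (M : ModuleCat.{u} R) :
    Submodule R (cochain f k M) := LinearMap.ker (d f k M)

/-- The coboundaries of the Čech complex. -/
noncomputable def coboundaries (f : ι → R) : (k : ℕ) → (M : ModuleCat.{u} R) →
    Submodule R (cochain f k M)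
  | 0, _ => ⊥
  | k + 1, M => LinearMap.range (d f k M)

lemma mem_cocycles {k : ℕ} {z : cochain f k M} : z ∈ cocycles f k M ↔ d f k M z = 0 := Iff.rfl

lemma coboundaries_le_cocycles (k : ℕ) (M : ModuleCat.{u} R) :
    coboundaries f k M ≤ cocycles f k M := by
  cases k with
  | zero => exact bot_le
  | succ k => rintro _ ⟨b, rfl⟩; exact d_d k M b

lemma map_mem_cocycles {k : ℕ} (φ : M →ₗ[R] N) {z : cochain f k M} (hz : z ∈ cocycles f k M) :
    map f k φ z ∈ cocycles f k N := by
  rw [mem_cocycles] at hz ⊢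
  rw [← map_d, hz, map_zero]

lemma map_mem_coboundaries {k : ℕ} (φ : M →ₗ[R] N) {z : cochain f k M}
    (hz : z ∈ coboundaries f k M) : map f k φ z ∈ coboundaries f k N := by
  cases k with
  | zero => rw [(Submodule.mem_bot R).1 hz, map_zero]; exact zero_mem _
  | succ k =>
    obtain ⟨b, rfl⟩ := hz
    exact ⟨map f k φ b, (map_d k φ b).symm⟩

end Basic
end Cech

/-! ### Acyclicity of the Čech complex of an injective module -/

section Torsion

variable {R : Type u} [CommRing R] {M N : Type*} [AddCommGroup M] [Module R M] [AddCommGroup N]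
  [Module R N]

/-- A linear map out of `M` that kills the kernel of `θ : M → N` extends along `θ` to `N`, if the
target satisfies Baer's criterion. -/
lemma Module.Baer.exists_comp_eq {E : Type*} [AddCommGroup E] [Module R E] (hE : Module.Baer R E)
    (θ : M →ₗ[R] N) (φ : M →ₗ[R] E) (h : LinearMap.ker θ ≤ LinearMap.ker φ) :
    ∃ ψ : N →ₗ[R] E, ψ ∘ₗ θ = φ := by
  obtain ⟨ψ, hψ⟩ := hE.extension_property ((LinearMap.ker θ).liftQ θ le_rfl)
    (LinearMap.ker_eq_bot.1 (Submodule.ker_liftQ_eq_bot' _ _ rfl)) ((LinearMap.ker θ).liftQ φ h)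
  refine ⟨ψ, LinearMap.ext fun x => ?_⟩
  exact LinearMap.congr_fun hψ (Submodule.Quotient.mk x)

lemma Localized.mkLinearMap_eq_zero_iff (a : R) (m : M) :
    LocalizedModule.mkLinearMap (Submonoid.powers a) M m = 0 ↔ ∃ n : ℕ, a ^ n • m = 0 := by
  rw [IsLocalizedModule.eq_zero_iff (Submonoid.powers a)]
  constructor
  · rintro ⟨⟨_, n, rfl⟩, h⟩
    exact ⟨n, h⟩
  · rintro ⟨n, h⟩
    exact ⟨⟨a ^ n, n, rfl⟩, h⟩

lemma Localized.exists_pow_smul_eq (a : R) (x : LocalizedModule (Submonoid.powers a) M) :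
    ∃ (n : ℕ) (m : M), a ^ n • x = LocalizedModule.mkLinearMap (Submonoid.powers a) M m := by
  obtain ⟨⟨m, ⟨_, n, rfl⟩⟩, h⟩ :=
    IsLocalizedModule.surj (Submonoid.powers a) (LocalizedModule.mkLinearMap (.powers a) M) x
  exact ⟨n, m, h⟩

lemma Localized.smul_bijective (a : R) :
    Function.Bijective fun x : LocalizedModule (Submonoid.powers a) M => a • x :=
  (Module.End.isUnit_iff _).1 (IsLocalizedModule.map_units
    (LocalizedModule.mkLinearMap (Submonoid.powers a) M) ⟨a, Submonoid.mem_powers a⟩)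

lemma Localized.pow_smul_injective (a : R) (n : ℕ) :
    Function.Injective fun x : LocalizedModule (Submonoid.powers a) M => a ^ n • x := by
  have := (Localized.smul_bijective (M := M) a).1.iterate n
  rwa [smul_iterate] at this

variable [IsNoetherianRing R] {E : Type*} [AddCommGroup E] [Module R E]

/-- Over a noetherian ring the `a`-power torsion of an injective module is injective; this is a
consequence of the Artin–Rees lemma. -/
lemma Module.Baer.ker_localization (hE : Module.Baer R E) (a : R) :
    Module.Baer R (LinearMap.ker (LocalizedModule.mkLinearMap (Submonoid.powers a) E)) := by
  intro J φ
  have hn : ∃ n : ℕ, ∀ x : J, a ^ n • (φ x : E) = 0 := by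
    obtain ⟨s, hs⟩ := (IsNoetherian.noetherian (⊤ : Submodule R J))
    choose n hn using fun x : J =>
      (Localized.mkLinearMap_eq_zero_iff a (φ x : E)).1 (φ x).2
    refine ⟨s.sup n, fun x => ?_⟩
    have hx : x ∈ Submodule.span R (s : Set J) := by rw [hs]; trivial
    induction hx using Submodule.span_induction with
    | mem y hy =>
      rw [← Nat.sub_add_cancel (Finset.le_sup (f := n) hy), pow_add, mul_smul, hn, smul_zero]
    | zero => simp
    | add y z _ _ hy hz => simp [hy, hz]
    | smul r y _ hy => simp [smul_comm _ r, hy]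
  obtain ⟨n, hn⟩ := hn
  -- by Artin–Rees, `J ∩ (a ^ m) ⊆ a ^ n J`, on which `φ` vanishes; so `φ` extends to a map from
  -- `R / (a ^ m)` to `E`, whose image consists of torsion elements
  obtain ⟨k, hk⟩ := Ideal.exists_pow_inf_eq_pow_smul (Ideal.span {a}) J
  let m := n + k
  let θ : J →ₗ[R] R ⧸ Ideal.span {a ^ m} := (Ideal.span {a ^ m}).mkQ ∘ₗ J.subtype
  have hθ : LinearMap.ker θ ≤
      LinearMap.ker ((LinearMap.ker (LocalizedModule.mkLinearMap (.powers a) E)).subtype ∘ₗ φ) := by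
    intro x hx
    have hx : (x : R) ∈ Ideal.span {a ^ m} := by
      rw [LinearMap.mem_ker] at hx
      exact (Submodule.Quotient.mk_eq_zero _).1 hx
    have hx' : (x : R) ∈ Ideal.span {a} ^ n • (Ideal.span {a} ^ k • ⊤ ⊓ J) := by
      have := hk m (Nat.le_add_left k n)
      rw [show m - k = n from Nat.add_sub_cancel n k] at this
      rw [← this]
      refine ⟨?_, x.2⟩
      rwa [Ideal.span_singleton_pow, smul_eq_mul, Ideal.mul_top]
    have hx'' : (x : R) ∈ Ideal.span {a ^ n} • J := by
      rw [Ideal.span_singleton_pow] at hx'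
      exact Submodule.smul_mono le_rfl inf_le_right hx'
    rw [Ideal.smul_eq_mul, Ideal.mem_span_singleton_mul] at hx''
    obtain ⟨z, hz, hzx⟩ := hx''
    have : x = a ^ n • (⟨z, hz⟩ : J) := Subtype.ext hzx.symm
    rw [LinearMap.mem_ker, this, map_smul]
    exact hn _
  obtain ⟨ψ, hψ⟩ := hE.exists_comp_eq θ _ hθ
  refine ⟨LinearMap.codRestrict _ (ψ ∘ₗ (Ideal.span {a ^ m}).mkQ) fun r => ?_, fun x hx => ?_⟩
  · refine (Localized.mkLinearMap_eq_zero_iff a _).2 ⟨m, ?_⟩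
    rw [LinearMap.comp_apply, ← map_smul, ← map_smul]
    have : (Ideal.span {a ^ m}).mkQ (a ^ m • r) = 0 := by
      refine (Submodule.Quotient.mk_eq_zero _).2 ?_
      exact Ideal.mul_mem_right _ _ (Ideal.mem_span_singleton_self _)
    rw [this, map_zero]
  · exact Subtype.ext (LinearMap.congr_fun hψ ⟨x, hx⟩)

/-- An injective module `E` over a noetherian ring maps onto its localization away from `a`. Given
`y / a ^ n`, choose `N` such that `a ^ (N + n)` and `a ^ N` have the same annihilator; then
`a ^ N • y` is divisible by `a ^ (N + n)` in `E`. -/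
lemma Module.Baer.localization_surjective (hE : Module.Baer R E) (a : R) :
    Function.Surjective (LocalizedModule.mkLinearMap (Submonoid.powers a) E) := by
  intro x
  obtain ⟨n, y, hy⟩ := Localized.exists_pow_smul_eq a x
  -- the annihilators of the powers of `a` stabilize
  have hN : ∃ N : ℕ, ∀ r : R, a ^ (N + n) * r = 0 → a ^ N * r = 0 := by
    obtain ⟨N, hN⟩ := monotone_stabilizes_iff_noetherian.2 ‹IsNoetherianRing R›
      ⟨fun j => LinearMap.ker (LinearMap.mulLeft R (a ^ j)), by
        intro i j hij r hr
        rw [LinearMap.mem_ker, LinearMap.mulLeft_apply] at hr ⊢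
        rw [← Nat.sub_add_cancel hij, pow_add, mul_assoc, hr, mul_zero]⟩
    refine ⟨N, fun r hr => ?_⟩
    have := hN (N + n) (Nat.le_add_right N n)
    have hr : r ∈ LinearMap.ker (LinearMap.mulLeft R (a ^ (N + n))) := hr
    exact this.symm.le hr
  obtain ⟨N, hN⟩ := hN
  obtain ⟨ψ, hψ⟩ := hE.exists_comp_eq (LinearMap.mulLeft R (a ^ (N + n)))
    (LinearMap.toSpanSingleton R E (a ^ N • y)) (by
      intro r hr
      rw [LinearMap.mem_ker, LinearMap.mulLeft_apply] at hr
      rw [LinearMap.mem_ker, LinearMap.toSpanSingleton_apply, smul_smul, mul_comm, hN r hr,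
        zero_smul])
  refine ⟨ψ 1, ?_⟩
  have h1 : a ^ (N + n) • ψ 1 = a ^ N • y := by
    have := LinearMap.congr_fun hψ 1
    rw [LinearMap.comp_apply, LinearMap.mulLeft_apply, mul_one, LinearMap.toSpanSingleton_apply,
      one_smul] at this
    rw [← this, ← map_smul, smul_eq_mul, mul_one]
  apply Localized.pow_smul_injective a (N + n)
  change a ^ (N + n) • _ = a ^ (N + n) • x
  rw [← map_smul, h1, map_smul, ← hy, smul_smul, pow_add]

end Torsion

namespace Cech

variable {R : Type u} [CommRing R] {ι : Type} {f : ι → R}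

/-- The Čech complex with coefficients in `M` is exact in positive degrees. -/
def Acyclic (f : ι → R) (M : ModuleCat.{u} R) : Prop :=
  ∀ k, cocycles f (k + 1) M ≤ coboundaries f (k + 1) M

/-- If `f i` acts bijectively on `M`, then taking the component at `i` is a contracting homotopy
of the Čech complex. -/
lemma acyclic_of_bijective {M : ModuleCat.{u} R} (i : ι)
    (h : Function.Bijective fun m : M => f i • m) : Acyclic f M := by
  have hpow : ∀ n : ℕ, Function.Bijective fun m : M => f i ^ n • m := fun n => by
    have := h.iterate n
    rwa [smul_iterate] at this
  have hinj : Function.Injective (toAway (f i) M) := by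
    refine (injective_iff_map_eq_zero _).2 fun m hm => ?_
    obtain ⟨n, hn⟩ := (Localized.mkLinearMap_eq_zero_iff (f i) m).1 hm
    exact (hpow n).1 (hn.trans (smul_zero _).symm)
  have hsurj : Function.Surjective (toAway (f i) M) := by
    intro x
    obtain ⟨n, y, hy⟩ := Localized.exists_pow_smul_eq (f i) x
    obtain ⟨m, rfl⟩ := (hpow n).2 y
    refine ⟨m, Localized.pow_smul_injective (f i) n ?_⟩
    change f i ^ n • _ = f i ^ n • x
    rw [hy, ← map_smul]
  intro k z hz
  obtain ⟨w, hw⟩ := map_surjective k _ hsurj (comp k M i z)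
  refine ⟨w, map_injective (k + 1) _ hinj ?_⟩
  have h0 := congrArg (comp (k + 1) M i) (mem_cocycles.1 hz)
  rw [comp_d_succ, map_zero, sub_eq_zero] at h0
  rw [map_d, hw, h0]

lemma Acyclic.of_exact {A B C : ModuleCat.{u} R} (φ : A →ₗ[R] B) (ψ : B →ₗ[R] C)
    (hφ : Function.Injective φ) (hψ : Function.Surjective ψ) (h : Function.Exact φ ψ)
    (hA : Acyclic f A) (hC : Acyclic f C) : Acyclic f B := by
  intro k z hz
  obtain ⟨c, hc⟩ := hC k (map_mem_cocycles ψ hz)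
  obtain ⟨b, rfl⟩ := map_surjective k ψ hψ c
  obtain ⟨a, ha⟩ := (map_exact (k + 1) φ ψ h (z - d f k B b)).1 (by
    rw [map_sub, ← hc, map_d, sub_self])
  obtain ⟨a', rfl⟩ := hA k (mem_cocycles.2 (map_injective (k + 2) φ hφ (by
    rw [map_d, ha, map_sub, mem_cocycles.1 hz, d_d, map_zero, sub_self]) : d f (k + 1) A a = 0))
  refine ⟨map f k φ a' + b, ?_⟩
  rw [map_add, ← map_d, ha, sub_add_cancel]

lemma cochain_subsingleton (k : ℕ) {M : ModuleCat.{u} R} (h : Subsingleton M) :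
    Subsingleton (cochain f k M) := by
  have hid : (LinearMap.id : M →ₗ[R] M) = 0 := LinearMap.ext fun _ => Subsingleton.elim _ _
  have h0 : (LinearMap.id : cochain f k M →ₗ[R] cochain f k M) = 0 := by
    rw [← map_id, hid, map_zero]
  exact ⟨fun x y => (LinearMap.congr_fun h0 x).trans (LinearMap.congr_fun h0 y).symm⟩

/-- If all localizations of `M` away from the `f i` vanish, then so do all cochains of positive
degree. -/
lemma acyclic_of_torsion {M : ModuleCat.{u} R} (h : ∀ (i : ι) (m : M), ∃ n : ℕ, f i ^ n • m = 0) :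
    Acyclic f M := by
  intro k z _
  have : z = 0 := by
    refine ext_comp fun i => (cochain_subsingleton k ?_).elim _ _
    refine subsingleton_of_forall_eq 0 fun x => ?_
    obtain ⟨n, y, hy⟩ := Localized.exists_pow_smul_eq (f i) x
    rw [(Localized.mkLinearMap_eq_zero_iff (f i) y).2 (h i y)] at hy
    exact Localized.pow_smul_injective (f i) n (hy.trans (smul_zero _).symm)
  rw [this]
  exact zero_mem _

/-- The Čech complex of an injective module over a noetherian ring is exact in positive degrees.
By induction the torsion with respect to the `f i` is split off for one index `i` after the other:
the quotient by the `f i`-power torsion is the localization away from `f i`. -/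
lemma acyclic_of_baer [Fintype ι] [IsNoetherianRing R] {E : ModuleCat.{u} R}
    (hE : Module.Baer R E) : Acyclic f E := by
  classical
  suffices h : ∀ (s : Finset ι) (E : ModuleCat.{u} R), Module.Baer R E →
      (∀ i ∉ s, ∀ m : E, ∃ n : ℕ, f i ^ n • m = 0) → Acyclic f E from
    h Finset.univ E hE fun i hi => absurd (Finset.mem_univ i) hi
  intro s
  induction s using Finset.induction_on with
  | empty => exact fun E _ h => acyclic_of_torsion fun i => h i (Finset.notMem_empty i)
  | insert i s _ ih =>
    intro E hE h
    refine Acyclic.of_exact (A := ModuleCat.of R (LinearMap.ker (toAway (f i) E)))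
      (LinearMap.ker (toAway (f i) E)).subtype (toAway (f i) E)
      (Submodule.injective_subtype _) (hE.localization_surjective (f i))
      (LinearMap.exact_subtype_ker_map _) (ih _ (hE.ker_localization (f i)) ?_)
      (acyclic_of_bijective i (Localized.smul_bijective (f i)))
    intro j hj m
    have : ∃ n : ℕ, f j ^ n • (m : E) = 0 := by
      by_cases hji : j = i
      · subst hji
        exact (Localized.mkLinearMap_eq_zero_iff (f j) (m : E)).1 m.2
      · exact h j (by simp [hji, hj]) m
    obtain ⟨n, hn⟩ := this
    exact ⟨n, Subtype.ext hn⟩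

/-- The cocycles of degree zero are the elements that are torsion with respect to the ideal
generated by the family `f`. -/
lemma mem_cocycles_zero_iff [Finite ι] {M : ModuleCat.{u} R} (m : M) :
    (show cochain f 0 M from m) ∈ cocycles f 0 M ↔
      ∃ n : ℕ, ∀ r ∈ Ideal.span (Set.range f) ^ n, r • m = 0 := by
  have : Fintype ι := Fintype.ofFinite ι
  have h1 : (show cochain f 0 M from m) ∈ cocycles f 0 M ↔ ∀ i, ∃ n : ℕ, f i ^ n • m = 0 := by
    constructor
    · intro h i
      exact (Localized.mkLinearMap_eq_zero_iff (f i) m).1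
        (congrArg (comp 0 M i) (mem_cocycles.1 h))
    · intro h
      exact ext_comp fun i => (Localized.mkLinearMap_eq_zero_iff (f i) m).2 (h i)
  rw [h1]
  constructor
  · intro h
    have hle : Ideal.span (Set.range f) ≤
        Ideal.radical (LinearMap.ker (LinearMap.toSpanSingleton R M m)) := by
      rw [Ideal.span_le]
      rintro _ ⟨i, rfl⟩
      obtain ⟨n, hn⟩ := h i
      exact ⟨n, hn⟩
    obtain ⟨n, hn⟩ := Ideal.exists_pow_le_of_le_radical_of_fg hle
      ((Submodule.fg_span (Set.finite_range f)))
    exact ⟨n, fun r hr => hn hr⟩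
  · rintro ⟨n, hn⟩ i
    exact ⟨n, hn _ (Ideal.pow_mem_pow (Ideal.subset_span (Set.mem_range_self i)) n)⟩

end Cech

/-! ### Cochains with bounded denominators -/

namespace Cech

section Bounded

variable {R : Type u} [CommRing R] {ι : Type} {f : ι → R} {M N : ModuleCat.{u} R}

lemma map_smul_id (r : R) (k : ℕ) :
    map f k (r • LinearMap.id : M →ₗ[R] M) = r • LinearMap.id := by
  rw [map_smul, map_id]

lemma smul_injective_away (i : ι) (n k : ℕ) :
    Function.Injective fun c : cochain f k (away (f i) M) => f i ^ n • c := by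
  have := map_injective (f := f) k ((f i ^ n) • LinearMap.id : away (f i) M →ₗ[R] away (f i) M)
    (Localized.pow_smul_injective (f i) n)
  rwa [map_smul_id] at this

/-- The cochains with denominators `f i ^ n`: the component at `i` of such a cochain of degree
`k + 1` is `b / f i ^ n`, where `b` is such a cochain of degree `k` that is defined before
localization away from `f i`. -/
noncomputable def bounded (f : ι → R) (n : ℕ) :
    (k : ℕ) → (M : ModuleCat.{u} R) → Submodule R (cochain f k M)
  | 0, _ => ⊤
  | k + 1, M => ⨅ i, (((bounded f n k M).map (map f k (toAway (f i) M))).comap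
      (f i ^ n • LinearMap.id)).comap (comp k M i)

lemma mem_bounded_succ {n k : ℕ} {c : cochain f (k + 1) M} : c ∈ bounded f n (k + 1) M ↔
    ∀ i, ∃ b ∈ bounded f n k M, map f k (toAway (f i) M) b = f i ^ n • comp k M i c := by
  simp only [bounded, Submodule.mem_iInf]
  rfl

lemma bounded_mono {n m : ℕ} (h : n ≤ m) (k : ℕ) : ∀ M : ModuleCat.{u} R,
    bounded f n k M ≤ bounded f m k M := by
  induction k with
  | zero => exact fun M => le_rfl
  | succ k ih =>
    intro M c hc
    refine mem_bounded_succ.2 fun i => ?_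
    obtain ⟨b, hb, hbc⟩ := mem_bounded_succ.1 hc i
    refine ⟨f i ^ (m - n) • b, Submodule.smul_mem _ _ (ih M hb), ?_⟩
    rw [map_smul, hbc, smul_smul, ← pow_add, Nat.sub_add_cancel h]

lemma map_mem_bounded (n k : ℕ) : ∀ {M N : ModuleCat.{u} R} (φ : M →ₗ[R] N) {c : cochain f k M},
    c ∈ bounded f n k M → map f k φ c ∈ bounded f n k N := by
  induction k with
  | zero => intros; trivial
  | succ k ih =>
    intro M N φ c hc
    refine mem_bounded_succ.2 fun i => ?_
    obtain ⟨b, hb, hbc⟩ := mem_bounded_succ.1 hc i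
    refine ⟨map f k φ b, ih φ hb, ?_⟩
    rw [comp_map, map_map, ← awayMap_toAway, ← map_smul, ← hbc, map_map]

/-- If every element of `N` is brought into the range of `φ` by a power of `a`, then the same holds
for cochains. -/
lemma exists_pow_smul_mem_range [Finite ι] (a : R) (k : ℕ) :
    ∀ {M N : ModuleCat.{u} R} (φ : M →ₗ[R] N), (∀ y, ∃ (n : ℕ) (x : M), φ x = a ^ n • y) →
      ∀ c : cochain f k N, ∃ (n : ℕ) (b : cochain f k M), map f k φ b = a ^ n • c := by
  have : Fintype ι := Fintype.ofFinite ι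
  induction k with
  | zero => intro M N φ h; exact h
  | succ k ih =>
    intro M N φ h c
    have hi := fun i => ih (awayMap (f i) φ) (fun y => by
      obtain ⟨m, y', hy'⟩ := Localized.exists_pow_smul_eq (f i) y
      obtain ⟨n, x, hx⟩ := h y'
      obtain ⟨x', hx'⟩ := (Function.Bijective.iterate
        (Localized.smul_bijective (M := M) (f i)) m).2 (toAway (f i) M x)
      rw [smul_iterate] at hx'
      refine ⟨n, x', Localized.pow_smul_injective (f i) m ?_⟩
      change f i ^ m • _ = f i ^ m • (a ^ n • y)
      rw [← map_smul, smul_comm, hy', ← map_smul, ← hx]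
      change awayMap (f i) φ (f i ^ m • x') = _
      rw [show f i ^ m • x' = _ from hx']
      exact LinearMap.congr_fun (awayMap_toAway (f i) φ) x) (comp k N i c)
    choose n b hb using hi
    refine ⟨Finset.univ.sup n,
      ofComp k M fun i => a ^ (Finset.univ.sup n - n i) • b i, ext_comp fun i => ?_⟩
    rw [comp_map, comp_ofComp, map_smul, hb, smul_smul, ← pow_add,
      Nat.sub_add_cancel (Finset.le_sup (Finset.mem_univ i)), map_smul]

lemma exists_mem_bounded [Finite ι] (k : ℕ) : ∀ {M : ModuleCat.{u} R} (c : cochain f k M),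
    ∃ n, c ∈ bounded f n k M := by
  have : Fintype ι := Fintype.ofFinite ι
  induction k with
  | zero => exact fun c => ⟨0, trivial⟩
  | succ k ih =>
    intro M c
    choose n b hb using fun i => exists_pow_smul_mem_range (f i) k (toAway (f i) M) (fun y => by
      obtain ⟨m, x, hx⟩ := Localized.exists_pow_smul_eq (f i) y
      exact ⟨m, x, hx.symm⟩) (comp k M i c)
    choose m hm using fun i => ih (b i)
    refine ⟨Finset.univ.sup fun i => n i + m i, mem_bounded_succ.2 fun i => ?_⟩
    have hi : n i + m i ≤ Finset.univ.sup fun i => n i + m i :=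
      Finset.le_sup (f := fun i => n i + m i) (Finset.mem_univ i)
    refine ⟨f i ^ ((Finset.univ.sup fun i => n i + m i) - n i) • b i,
      Submodule.smul_mem _ _ (bounded_mono ((Nat.le_add_left _ _).trans hi) k M (hm i)), ?_⟩
    rw [map_smul, hb, smul_smul, ← pow_add, Nat.sub_add_cancel ((Nat.le_add_right _ _).trans hi)]

/-- Multiplication by `f i ^ n` embeds the components of cochains with denominators `f i ^ n` into
quotients of modules of cochains of lower degree. -/
lemma isNoetherian_bounded [Finite ι] (n k : ℕ) (M : ModuleCat.{u} R) [IsNoetherian R M] :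
    IsNoetherian R (bounded f n k M) := by
  induction k with
  | zero => exact isNoetherian_of_linearEquiv (Submodule.topEquiv (R := R) (M := M)).symm
  | succ k ih =>
    have (i : ι) : IsNoetherian R ((bounded f n k M).map (map f k (toAway (f i) M))) :=
      isNoetherian_of_surjective ((map f k (toAway (f i) M)).submoduleMap (bounded f n k M))
        (LinearMap.range_eq_top.2 (LinearMap.submoduleMap_surjective _ _))
    refine isNoetherian_of_injective (LinearMap.pi fun i => LinearMap.codRestrict
      ((bounded f n k M).map (map f k (toAway (f i) M)))
      ((f i ^ n • LinearMap.id) ∘ₗ comp k M i ∘ₗ (bounded f n (k + 1) M).subtype)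
      fun c => let ⟨b, hb, h⟩ := mem_bounded_succ.1 c.2 i; ⟨b, hb, h⟩) (fun c c' h => ?_)
    refine Subtype.ext (ext_comp fun i => smul_injective_away i n k ?_)
    exact congrArg Subtype.val (congrFun h i)

end Bounded

/-! ### The Čech complex of a Frobenius pushforward -/

section Frobenius

variable {R : Type u} [CommRing R] {ι : Type} {f : ι → R} {M N : ModuleCat.{u} R}
variable {F : R →+* R} {q : ℕ}

/-- A linear map, regarded as a map between the modules obtained by restriction of scalars. -/
noncomputable abbrev restrict (F : R →+* R) (φ : M →ₗ[R] N) :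
    (ModuleCat.restrictScalars F).obj M →ₗ[R] (ModuleCat.restrictScalars F).obj N :=
  ((ModuleCat.restrictScalars F).map (ModuleCat.ofHom φ)).hom

/-- If `F` is the power map `a ↦ a ^ q`, then restriction of scalars along `F` commutes with
localization away from `a`. -/
lemma isLocalizedModule_restrict (hF : ∀ a, F a = a ^ q) (hq : q ≠ 0) (a : R)
    (M : ModuleCat.{u} R) :
    IsLocalizedModule (Submonoid.powers a) (restrict F (toAway a M)) where
  map_units := by
    rintro ⟨_, n, rfl⟩
    rw [Module.End.isUnit_iff]
    have := (Localized.smul_bijective (M := M) a).iterate (n * q)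
    rw [smul_iterate, pow_mul, ← hF] at this
    exact this
  surj := by
    intro (x : away a M)
    obtain ⟨n, m, h⟩ := Localized.exists_pow_smul_eq (M := M) a x
    refine ⟨⟨(a ^ (n * q - n) • m : M), ⟨a ^ n, n, rfl⟩⟩, ?_⟩
    change F (a ^ n) • x = toAway a M (a ^ (n * q - n) • m)
    rw [map_smul, ← h, smul_smul, ← pow_add,
      Nat.sub_add_cancel (Nat.le_mul_of_pos_right n (Nat.pos_of_ne_zero hq)), hF, ← pow_mul]
  exists_of_eq := by
    intro (x : M) (y : M) h
    obtain ⟨⟨_, n, rfl⟩, h⟩ := IsLocalizedModule.exists_of_eq (S := Submonoid.powers a)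
      (f := toAway a M) h
    refine ⟨⟨a ^ n, n, rfl⟩, ?_⟩
    change F (a ^ n) • x = F (a ^ n) • y
    replace h : a ^ n • x = a ^ n • y := h
    have hpow : F (a ^ n) = a ^ (n * q - n) * a ^ n := by
      rw [hF, ← pow_mul, ← pow_add,
        Nat.sub_add_cancel (Nat.le_mul_of_pos_right n (Nat.pos_of_ne_zero hq))]
    rw [hpow, mul_smul, mul_smul, h]

/-- The comparison of localization away from `a` with restriction of scalars along the power map
`F`. -/
noncomputable def awayRestrict (hF : ∀ a, F a = a ^ q) (hq : q ≠ 0) (a : R)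
    (M : ModuleCat.{u} R) : away a ((ModuleCat.restrictScalars F).obj M) ≃ₗ[R]
      (ModuleCat.restrictScalars F).obj (away a M) :=
  have := isLocalizedModule_restrict hF hq a M
  IsLocalizedModule.iso (Submonoid.powers a) (restrict F (toAway a M))

lemma awayRestrict_toAway (hF : ∀ a, F a = a ^ q) (hq : q ≠ 0) (a : R) (M : ModuleCat.{u} R) :
    (awayRestrict hF hq a M).toLinearMap ∘ₗ toAway a _ = restrict F (toAway a M) :=
  have := isLocalizedModule_restrict hF hq a M
  LinearMap.ext fun m => IsLocalizedModule.iso_mk_one _ _ m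

lemma awayRestrict_awayMap (hF : ∀ a, F a = a ^ q) (hq : q ≠ 0) (a : R) (φ : M →ₗ[R] N) :
    (awayRestrict hF hq a N).toLinearMap ∘ₗ awayMap a (restrict F φ) =
      restrict F (awayMap a φ) ∘ₗ (awayRestrict hF hq a M).toLinearMap := by
  have := isLocalizedModule_restrict hF hq a N
  refine IsLocalizedModule.linearMap_ext (Submonoid.powers a) (toAway a _)
    (restrict F (toAway a N)) ?_
  rw [LinearMap.comp_assoc, LinearMap.comp_assoc, awayMap_toAway, awayRestrict_toAway,
    ← LinearMap.comp_assoc, awayRestrict_toAway]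
  refine LinearMap.ext fun m => ?_
  exact (LinearMap.congr_fun (awayMap_toAway a φ) m).symm

/-- The cochains with coefficients in the restriction of scalars of `M` along the power map `F`
are the cochains with coefficients in `M`. -/
noncomputable def theta (f : ι → R) (hF : ∀ a, F a = a ^ q) (hq : q ≠ 0) :
    (k : ℕ) → (M : ModuleCat.{u} R) →
    (cochain f k ((ModuleCat.restrictScalars F).obj M) →ₛₗ[F] cochain f k M)
  | 0, M =>
    { toFun := fun m => (show (ModuleCat.restrictScalars F).obj M from m)
      map_add' := fun _ _ => rfl
      map_smul' := fun _ _ => rfl }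
  | k + 1, M =>
    { toFun := fun c => ofComp k M fun i => theta f hF hq k (away (f i) M)
        (map f k (awayRestrict hF hq (f i) M).toLinearMap (comp k _ i c))
      map_add' := fun c c' => ext_comp fun i => by
        simp only [map_add, comp_ofComp]
      map_smul' := fun r c => ext_comp fun i => by
        simp only [map_smul, comp_ofComp, LinearMap.map_smulₛₗ] }

variable (hF : ∀ a, F a = a ^ q) (hq : q ≠ 0)

lemma comp_theta (k : ℕ) (i : ι) (c : cochain f (k + 1) ((ModuleCat.restrictScalars F).obj M)) :
    comp k M i (theta f hF hq (k + 1) M c) = theta f hF hq k (away (f i) M)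
      (map f k (awayRestrict hF hq (f i) M).toLinearMap (comp k _ i c)) := rfl

lemma theta_map (k : ℕ) : ∀ {M N : ModuleCat.{u} R} (φ : M →ₗ[R] N)
    (c : cochain f k ((ModuleCat.restrictScalars F).obj M)),
    theta f hF hq k N (map f k (restrict F φ) c) = map f k φ (theta f hF hq k M c) := by
  induction k with
  | zero => intros; rfl
  | succ k ih =>
    intro M N φ c
    refine ext_comp fun i => ?_
    rw [comp_theta, comp_map, map_map, awayRestrict_awayMap, ← map_map, ih, comp_map, comp_theta]

lemma theta_d (k : ℕ) : ∀ {M : ModuleCat.{u} R}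
    (c : cochain f k ((ModuleCat.restrictScalars F).obj M)),
    theta f hF hq (k + 1) M (d f k _ c) = d f k M (theta f hF hq k M c) := by
  induction k with
  | zero =>
    intro M c
    refine ext_comp fun i => ?_
    rw [comp_theta, comp_d_zero, comp_d_zero]
    exact LinearMap.congr_fun (awayRestrict_toAway hF hq (f i) M) c
  | succ k ih =>
    intro M c
    refine ext_comp fun i => ?_
    rw [comp_theta, comp_d_succ, comp_d_succ, map_sub, map_sub, map_map, awayRestrict_toAway,
      theta_map, map_d, ih, comp_theta]

lemma theta_bijective (k : ℕ) : ∀ M : ModuleCat.{u} R,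
    Function.Bijective (theta f hF hq k M) := by
  induction k with
  | zero => exact fun M => Function.bijective_id
  | succ k ih =>
    intro M
    constructor
    · intro c c' h
      refine ext_comp fun i => map_injective k _ (awayRestrict hF hq (f i) M).injective
        ((ih _).1 ?_)
      rw [← comp_theta, h, comp_theta]
    · intro c
      choose b hb using fun i => (ih (away (f i) M)).2 (comp k M i c)
      choose a ha using fun i => map_surjective k (awayRestrict hF hq (f i) M).toLinearMap
        (awayRestrict hF hq (f i) M).surjective (b i)
      refine ⟨ofComp k _ a, ext_comp fun i => ?_⟩
      rw [comp_theta, comp_ofComp, ha, hb]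

lemma theta_mem_cocycles {k : ℕ} {c : cochain f k ((ModuleCat.restrictScalars F).obj M)} :
    theta f hF hq k M c ∈ cocycles f k M ↔ c ∈ cocycles f k _ := by
  rw [mem_cocycles, mem_cocycles, ← theta_d, map_eq_zero_iff _ (theta_bijective hF hq (k + 1) M).1]

lemma theta_mem_coboundaries {k : ℕ} {c : cochain f k ((ModuleCat.restrictScalars F).obj M)} :
    theta f hF hq k M c ∈ coboundaries f k M ↔ c ∈ coboundaries f k _ := by
  cases k with
  | zero =>
    change theta f hF hq 0 M c = 0 ↔ c = 0
    rw [map_eq_zero_iff _ (theta_bijective hF hq 0 M).1]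
  | succ k =>
    constructor
    · rintro ⟨b, hb⟩
      obtain ⟨b, rfl⟩ := (theta_bijective hF hq k M).2 b
      exact ⟨b, (theta_bijective hF hq (k + 1) M).1 (by rw [theta_d, hb])⟩
    · rintro ⟨b, rfl⟩
      exact ⟨theta f hF hq k M b, (theta_d hF hq k b).symm⟩

/-- Under the identification `theta`, denominators `f i` become denominators `f i ^ q`. -/
lemma mem_bounded_of_theta (k : ℕ) : ∀ {M : ModuleCat.{u} R}
    {c : cochain f k ((ModuleCat.restrictScalars F).obj M)},
    theta f hF hq k M c ∈ bounded f q k M → c ∈ bounded f 1 k _ := by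
  induction k with
  | zero => intros; trivial
  | succ k ih =>
    intro M c hc
    refine mem_bounded_succ.2 fun i => ?_
    obtain ⟨b, hb, hbc⟩ := mem_bounded_succ.1 hc i
    obtain ⟨b, rfl⟩ := (theta_bijective hF hq k M).2 b
    refine ⟨b, ih hb, map_injective k _ (awayRestrict hF hq (f i) M).injective
      ((theta_bijective hF hq k _).1 ?_)⟩
    rw [map_map, awayRestrict_toAway, theta_map, hbc, comp_theta, pow_one, map_smul,
      LinearMap.map_smulₛₗ, hF]

end Frobenius

end Cech

/-! ### Cocycles representing elements of `Ext` and of local cohomology -/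

namespace ModuleComplex

variable {R : Type u} [CommRing R]

lemma exists_iCycles_eq (K : CochainComplex (ModuleCat.{u} R) ℕ) (k : ℕ) (z : K.X k)
    (hz : K.d k (k + 1) z = 0) : ∃ c : K.cycles k, K.iCycles k c = z := by
  have hex : (ShortComplex.mk (K.iCycles k) (K.d k (k + 1)) (K.iCycles_d k (k + 1))).Exact :=
    ShortComplex.exact_of_f_is_kernel _ (K.cyclesIsKernel k (k + 1) (by simp))
  exact (ShortComplex.moduleCat_exact_iff _).1 hex z hz

lemma homologyπ_surjective (K : CochainComplex (ModuleCat.{u} R) ℕ) (k : ℕ) :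
    Function.Surjective (K.homologyπ k) :=
  (ModuleCat.epi_iff_surjective _).1 inferInstance

lemma iCycles_injective (K : CochainComplex (ModuleCat.{u} R) ℕ) (k : ℕ) :
    Function.Injective (K.iCycles k) :=
  (ModuleCat.mono_iff_injective _).1 inferInstance

/-- The coboundaries of a cochain complex of modules. -/
def coboundaries (K : CochainComplex (ModuleCat.{u} R) ℕ) : (k : ℕ) → Submodule R (K.X k)
  | 0 => ⊥
  | k + 1 => LinearMap.range (K.d k (k + 1)).hom

lemma homologyπ_eq_zero_iff (K : CochainComplex (ModuleCat.{u} R) ℕ) (k : ℕ) (c : K.cycles k) :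
    K.homologyπ k c = 0 ↔ K.iCycles k c ∈ coboundaries K k := by
  cases k with
  | zero =>
    have : IsIso (K.homologyπ 0) := K.isIso_homologyπ _ 0 rfl (by simp)
    have hinj : Function.Injective (K.homologyπ 0) :=
      (ModuleCat.mono_iff_injective _).1 inferInstance
    change _ ↔ K.iCycles 0 c = 0
    rw [map_eq_zero_iff _ hinj, map_eq_zero_iff _ (iCycles_injective K 0)]
  | succ k =>
    have hex : (ShortComplex.mk (K.toCycles k (k + 1)) (K.homologyπ (k + 1))
        (K.toCycles_comp_homologyπ k (k + 1))).Exact :=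
      ShortComplex.exact_of_g_is_cokernel _ (K.homologyIsCokernel k (k + 1) (by simp))
    constructor
    · intro h
      obtain ⟨b, hb⟩ := (ShortComplex.moduleCat_exact_iff _).1 hex c h
      refine ⟨b, ?_⟩
      rw [← hb]
      exact (ConcreteCategory.congr_hom (K.toCycles_i k (k + 1)) b).symm
    · rintro ⟨b, hb⟩
      have : c = K.toCycles k (k + 1) b := iCycles_injective K (k + 1) (by
        rw [← hb]
        exact (ConcreteCategory.congr_hom (K.toCycles_i k (k + 1)) b).symm)
      rw [this]
      exact ConcreteCategory.congr_hom (K.toCycles_comp_homologyπ k (k + 1)) b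

end ModuleComplex

namespace ExtRep

variable {R : Type u} [CommRing R] {X X' : ModuleCat.{u} R}

/-- The homomorphism `φ` is a cocycle that represents the element `x` of `Ext`, computed by means
of the projective resolution `P`. -/
def Rep (P : ProjectiveResolution X) {Y : ModuleCat.{u} R} {k : ℕ} (φ : P.complex.X k ⟶ Y)
    (x : ((Ext R (ModuleCat.{u} R) k).obj (Opposite.op X)).obj Y) : Prop :=
  ∃ c : (P.complex.linearYonedaObj R Y).cycles k,
    (P.complex.linearYonedaObj R Y).iCycles k c = φ ∧
      (P.isoExt (R := R) k Y).hom x = (P.complex.linearYonedaObj R Y).homologyπ k c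

variable (P : ProjectiveResolution X) {Y : ModuleCat.{u} R} {k : ℕ}

lemma Rep.exists (x : ((Ext R (ModuleCat.{u} R) k).obj (Opposite.op X)).obj Y) :
    ∃ φ : P.complex.X k ⟶ Y, P.complex.d (k + 1) k ≫ φ = 0 ∧ Rep P φ x := by
  obtain ⟨c, hc⟩ := ModuleComplex.homologyπ_surjective _ k ((P.isoExt (R := R) k Y).hom x)
  exact ⟨_, ConcreteCategory.congr_hom
    ((P.complex.linearYonedaObj R Y).iCycles_d k (k + 1)) c, c, rfl, hc.symm⟩

lemma Rep.of_cocycle (φ : P.complex.X k ⟶ Y) (hφ : P.complex.d (k + 1) k ≫ φ = 0) :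
    ∃ x, Rep P φ x := by
  obtain ⟨c, hc⟩ := ModuleComplex.exists_iCycles_eq (P.complex.linearYonedaObj R Y) k φ hφ
  exact ⟨(P.isoExt (R := R) k Y).inv ((P.complex.linearYonedaObj R Y).homologyπ k c), c, hc, by simp⟩

variable {P}

/-- The coboundaries in the complex of homomorphisms from a projective resolution. -/
def IsCoboundary : (k : ℕ) → (P.complex.X k ⟶ Y) → Prop
  | 0, φ => φ = 0
  | k + 1, φ => ∃ ψ : P.complex.X k ⟶ Y, P.complex.d (k + 1) k ≫ ψ = φ

lemma Rep.eq_zero_iff {φ : P.complex.X k ⟶ Y}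
    {x : ((Ext R (ModuleCat.{u} R) k).obj (Opposite.op X)).obj Y} (h : Rep P φ x) :
    x = 0 ↔ IsCoboundary k φ := by
  obtain ⟨c, rfl, hc⟩ := h
  have hinj : Function.Injective (P.isoExt (R := R) k Y).hom :=
    (ModuleCat.mono_iff_injective _).1 inferInstance
  rw [← map_eq_zero_iff _ hinj, hc, ModuleComplex.homologyπ_eq_zero_iff]
  cases k <;> rfl

lemma Rep.smul {φ : P.complex.X k ⟶ Y}
    {x : ((Ext R (ModuleCat.{u} R) k).obj (Opposite.op X)).obj Y} (h : Rep P φ x) (r : R) :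
    Rep P (r • φ) (r • x) := by
  obtain ⟨c, rfl, hc⟩ := h
  exact ⟨r • c, map_smul _ _ _, by rw [map_smul, map_smul, hc]⟩

section

open Opposite HomologicalComplex

variable {V : Type*} [Category V] [Limits.HasZeroMorphisms V] {ι : Type*} {c : ComplexShape ι}

lemma homologyUnop_hom_naturality {K L : HomologicalComplex Vᵒᵖ c} (ψ : K ⟶ L) (i : ι)
    [K.HasHomology i] [L.HasHomology i] :
    homologyMap ((unopFunctor V c).map ψ.op) i ≫ (K.homologyUnop i).hom =
      (L.homologyUnop i).hom ≫ (homologyMap ψ i).unop := by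
  exact (congrArg Quiver.Hom.unop
    (homologyOp_hom_naturality ((unopFunctor V c).map ψ.op) i)).symm

end

lemma hom_comp_eq_of_iso {V : Type*} [Category V] {A A' B B' C C' : V} (e : A ⟶ A') (i : B ≅ A)
    (i' : B' ≅ A') (u : C ≅ B) (u' : C' ≅ B') (m : B ⟶ B') (n : C ⟶ C')
    (h : m ≫ i'.hom = i.hom ≫ e) (h' : n ≫ u'.hom = u.hom ≫ m) :
    e ≫ (i'.symm ≪≫ u'.symm).hom = (i.symm ≪≫ u.symm).hom ≫ n := by
  simp only [Iso.trans_hom, Iso.symm_hom]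
  rw [← Category.assoc, Iso.comp_inv_eq, Category.assoc, Category.assoc, h',
    Iso.inv_hom_id_assoc, Iso.comp_inv_eq, Category.assoc, h, Iso.inv_hom_id_assoc]

lemma Rep.map {P' : ProjectiveResolution X'} (f : X' ⟶ X) {φ : P.complex.X k ⟶ Y}
    {x : ((Ext R (ModuleCat.{u} R) k).obj (Opposite.op X)).obj Y} (h : Rep P φ x) :
    Rep P' ((ProjectiveResolution.lift f P' P).f k ≫ φ)
      ((((Ext R (ModuleCat.{u} R) k).map f.op).app Y) x) := by
  let Φ := (((linearYoneda R (ModuleCat.{u} R)).obj Y).rightOp.mapHomologicalComplex _).map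
    (ProjectiveResolution.lift f P' P)
  let Ψ : P.complex.linearYonedaObj R Y ⟶ P'.complex.linearYonedaObj R Y :=
    (HomologicalComplex.unopFunctor _ _).map Φ.op
  have hnat : ((Ext R (ModuleCat.{u} R) k).map f.op).app Y ≫ (P'.isoExt (R := R) k Y).hom =
      (P.isoExt (R := R) k Y).hom ≫ HomologicalComplex.homologyMap Ψ k := by
    have h1 := ProjectiveResolution.isoLeftDerivedObj_hom_naturality f P' P
      (ProjectiveResolution.lift f P' P) (ProjectiveResolution.lift_commutes_zero f P' P)
      ((linearYoneda R (ModuleCat.{u} R)).obj Y).rightOp k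
    exact hom_comp_eq_of_iso _ (P.isoLeftDerivedObj _ k).unop (P'.isoLeftDerivedObj _ k).unop
      _ _ _ _ (congrArg Quiver.Hom.unop h1).symm (homologyUnop_hom_naturality Φ k)
  obtain ⟨c, rfl, hc⟩ := h
  refine ⟨HomologicalComplex.cyclesMap Ψ k c, ?_, ?_⟩
  · exact ConcreteCategory.congr_hom (HomologicalComplex.cyclesMap_i Ψ k) c
  · have h1 := ConcreteCategory.congr_hom hnat x
    refine h1.trans ?_
    rw [ConcreteCategory.comp_apply, hc]
    exact ConcreteCategory.congr_hom (HomologicalComplex.homologyπ_naturality Ψ k) c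

end ExtRep

namespace LocalCohomologyRep

open Opposite Limits ExtRep

variable {R : Type u} [CommRing R] (I : Ideal R)

/-- The module `R ⧸ I ^ t`. -/
noncomputable abbrev quotPow (t : ℕ) : ModuleCat.{u} R := ModuleCat.of R (R ⧸ I ^ t)

/-- A projective resolution of `R ⧸ I ^ t`. -/
noncomputable abbrev res (t : ℕ) : ProjectiveResolution (quotPow I t) :=
  projectiveResolution (quotPow I t)

variable {I}

/-- The projection `R ⧸ I ^ t' → R ⧸ I ^ t` for `t ≤ t'`. -/
noncomputable abbrev proj {t t' : ℕ} (h : t ≤ t') : quotPow I t' ⟶ quotPow I t :=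
  ModuleCat.ofHom (Submodule.mapQ _ _ LinearMap.id (Ideal.pow_le_pow_right h))

/-- A chain map between the resolutions that lifts the projection. -/
noncomputable abbrev transition {t t' : ℕ} (h : t ≤ t') : (res I t').complex ⟶ (res I t).complex :=
  ProjectiveResolution.lift (proj h) (res I t') (res I t)

/-- The map from `Ext` into local cohomology. -/
noncomputable def fromExt (k : ℕ) (M : ModuleCat.{u} R) (t : ℕ) :
    ((Ext R (ModuleCat.{u} R) k).obj (op (quotPow I t))).obj M ⟶ (localCohomology I k).obj M :=
  (colimit.ι (localCohomology.diagram (localCohomology.idealPowersDiagram I) k) (op (op t))).app M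

instance (D : ℕᵒᵖᵒᵖ ⥤ ModuleCat.{u} R) : PreservesColimit D (forget (ModuleCat.{u} R)) :=
  have : PreservesFilteredColimitsOfSize.{0, 0} (forget (ModuleCat.{u} R)) :=
    preservesFilteredColimitsOfSize_shrink.{0, u, 0, u} _
  have := this.preserves_filtered_colimits ℕᵒᵖᵒᵖ
  inferInstance

lemma fromExt_surjective (k : ℕ) (M : ModuleCat.{u} R) (x : (localCohomology I k).obj M) :
    ∃ t y, fromExt (I := I) k M t y = x := by
  let D := localCohomology.diagram (localCohomology.idealPowersDiagram I) k
  let hc := isColimitOfPreserves ((evaluation _ _).obj M) (colimit.isColimit D)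
  obtain ⟨⟨⟨t⟩⟩, y, hy⟩ := Concrete.isColimit_exists_rep _ hc x
  exact ⟨t, y, hy⟩

lemma fromExt_eq_zero_iff (k : ℕ) (M : ModuleCat.{u} R) (t : ℕ)
    (y : ((Ext R (ModuleCat.{u} R) k).obj (op (quotPow I t))).obj M) :
    fromExt (I := I) k M t y = 0 ↔ ∃ (t' : ℕ) (h : t ≤ t'),
      ((Ext R (ModuleCat.{u} R) k).map (proj (I := I) h).op).app M y = 0 := by
  let D := localCohomology.diagram (localCohomology.idealPowersDiagram I) k
  let hc := isColimitOfPreserves ((evaluation _ _).obj M) (colimit.isColimit D)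
  constructor
  · intro h
    obtain ⟨⟨⟨t'⟩⟩, f, g, hfg⟩ := (Concrete.isColimit_rep_eq_iff_exists _ hc
      (i := op (op t)) (j := op (op t)) y 0).1 (h.trans (map_zero _).symm)
    refine ⟨t', f.unop.unop.down.down, ?_⟩
    exact hfg.trans (map_zero _)
  · rintro ⟨t', h, hy⟩
    have := (Concrete.isColimit_rep_eq_iff_exists _ hc (i := op (op t)) (j := op (op t)) y 0).2
      ⟨op (op t'), (homOfLE h).op.op, (homOfLE h).op.op, hy.trans (map_zero _).symm⟩
    exact this.trans (map_zero _)

/-- Elements of local cohomology are represented by cocycles with values in `M` on the chosen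
projective resolutions of the modules `R ⧸ I ^ t`, so that vanishing of the localization of local
cohomology can be checked on such cocycles. -/
lemma forall_exists_smul_eq_zero_iff (S : Submonoid R) (k : ℕ) (M : ModuleCat.{u} R) :
    (∀ x : (localCohomology I k).obj M, ∃ s ∈ S, s • x = 0) ↔
      ∀ (t : ℕ) (φ : (res I t).complex.X k ⟶ M), (res I t).complex.d (k + 1) k ≫ φ = 0 →
        ∃ s ∈ S, ∃ (t' : ℕ) (h : t ≤ t'),
          IsCoboundary (P := res I t') k (s • ((transition h).f k ≫ φ)) := by
  constructor
  · intro H t φ hφ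
    obtain ⟨y, hy⟩ := Rep.of_cocycle _ φ hφ
    obtain ⟨s, hs, hsy⟩ := H (fromExt k M t y)
    rw [← map_smul, fromExt_eq_zero_iff] at hsy
    obtain ⟨t', h, h0⟩ := hsy
    refine ⟨s, hs, t', h, ?_⟩
    rw [map_smul] at h0
    exact (((hy.map (P' := res I t') (proj h)).smul s).eq_zero_iff).1 h0
  · intro H x
    obtain ⟨t, y, rfl⟩ := fromExt_surjective k M x
    obtain ⟨φ, hφ, hy⟩ := Rep.exists (res I t) y
    obtain ⟨s, hs, t', h, h0⟩ := H t φ hφ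
    refine ⟨s, hs, ?_⟩
    rw [← map_smul, fromExt_eq_zero_iff]
    refine ⟨t', h, ?_⟩
    rw [map_smul]
    exact (((hy.map (P' := res I t') (proj h)).smul s).eq_zero_iff).2 h0

end LocalCohomologyRep

/-! ### Dimension shifting -/

namespace LocalCohomologyRep

open Opposite Limits ExtRep

variable {R : Type u} [CommRing R] {I : Ideal R}

/-- After localization at `S`, the `Ext` cocycles of degree `k` with values in `M` vanish in local
cohomology. -/
def VanishExt (I : Ideal R) (S : Submonoid R) (k : ℕ) (M : ModuleCat.{u} R) : Prop :=
  ∀ (t : ℕ) (φ : (res I t).complex.X k ⟶ M), (res I t).complex.d (k + 1) k ≫ φ = 0 →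
    ∃ s ∈ S, ∃ (t' : ℕ) (h : t ≤ t'),
      IsCoboundary (P := res I t') k (s • ((transition h).f k ≫ φ))

/-- After localization at `S`, the `Ext` cocycles of degree `k` with values in `Q` lift to cocycles
with values in `E`. -/
def LiftExt (I : Ideal R) (S : Submonoid R) (k : ℕ) {E Q : ModuleCat.{u} R} (ψ : E ⟶ Q) : Prop :=
  ∀ (t : ℕ) (ζ : (res I t).complex.X k ⟶ Q), (res I t).complex.d (k + 1) k ≫ ζ = 0 →
    ∃ s ∈ S, ∃ (t' : ℕ) (h : t ≤ t') (η : (res I t').complex.X k ⟶ E),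
      (res I t').complex.d (k + 1) k ≫ η = 0 ∧ η ≫ ψ = s • ((transition h).f k ≫ ζ)

lemma exists_d_comp_eq {X : ModuleCat.{u} R} (P : ProjectiveResolution X) {E : ModuleCat.{u} R}
    [Injective E] {k : ℕ} (φ : P.complex.X (k + 1) ⟶ E)
    (h : P.complex.d (k + 2) (k + 1) ≫ φ = 0) :
    ∃ b : P.complex.X k ⟶ E, P.complex.d (k + 1) k ≫ b = φ :=
  ⟨(P.exact_succ k).descToInjective φ h, (P.exact_succ k).comp_descToInjective φ h⟩

variable {T : ShortComplex (ModuleCat.{u} R)} (hT : T.ShortExact) (S : Submonoid R)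

include hT

/-- Dimension shifting: cocycles with values in `T.X₁` of degree `k + 1` correspond to cocycles with
values in `T.X₃` of degree `k` modulo those that lift to `T.X₂`. -/
lemma vanishExt_succ_iff [Injective T.X₂] (k : ℕ) :
    VanishExt I S (k + 1) T.X₁ ↔ LiftExt I S k T.g := by
  have := hT.mono_f
  have := hT.epi_g
  constructor
  · intro H t ζ hζ
    obtain ⟨b, hb⟩ : ∃ b, b ≫ T.g = ζ := ⟨Projective.factorThru ζ T.g, Projective.factorThru_comp _ _⟩
    obtain ⟨a, ha⟩ : ∃ a, a ≫ T.f = (res I t).complex.d (k + 1) k ≫ b :=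
      ⟨hT.exact.lift _ (by rw [Category.assoc, hb, hζ]), hT.exact.lift_f _ _⟩
    obtain ⟨s, hs, t', h, a', ha'⟩ := H t a (by
      rw [← cancel_mono T.f, Category.assoc, ha, ← Category.assoc, HomologicalComplex.d_comp_d,
        zero_comp, zero_comp])
    refine ⟨s, hs, t', h, s • ((transition h).f k ≫ b) - a' ≫ T.f, ?_, ?_⟩
    · rw [Preadditive.comp_sub, Linear.comp_smul, ← Category.assoc _ a', ha', Linear.smul_comp,
        Category.assoc, ha, ← Category.assoc _ _ b, ← Category.assoc _ _ b,
        HomologicalComplex.Hom.comm, sub_self]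
    · rw [Preadditive.sub_comp, Linear.smul_comp, Category.assoc, hb, Category.assoc, T.zero,
        comp_zero, sub_zero]
  · intro H t a ha
    obtain ⟨b, hb⟩ := exists_d_comp_eq (res I t) (a ≫ T.f) (by
      rw [← Category.assoc, ha, zero_comp])
    obtain ⟨s, hs, t', h, η, hη, hηs⟩ := H t (b ≫ T.g) (by
      rw [← Category.assoc, hb, Category.assoc, T.zero, comp_zero])
    obtain ⟨a', ha'⟩ : ∃ a', a' ≫ T.f = s • ((transition h).f k ≫ b) - η :=
      ⟨hT.exact.lift _ (by
        rw [Preadditive.sub_comp, hηs, Linear.smul_comp, Category.assoc, sub_self]),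
        hT.exact.lift_f _ _⟩
    refine ⟨s, hs, t', h, a', ?_⟩
    rw [← cancel_mono T.f, Category.assoc, ha', Preadditive.comp_sub, hη, sub_zero,
      Linear.comp_smul, ← Category.assoc, ← HomologicalComplex.Hom.comm, Category.assoc, hb,
      Linear.smul_comp, Category.assoc]

/-- In positive degrees the cocycles with values in the injective object `T.X₂` are coboundaries, so
that only coboundaries lift. -/
lemma liftExt_succ_iff [Injective T.X₂] (k : ℕ) :
    LiftExt I S (k + 1) T.g ↔ VanishExt I S (k + 1) T.X₃ := by
  have := hT.epi_g
  constructor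
  · intro H t ζ hζ
    obtain ⟨s, hs, t', h, η, hη, hηs⟩ := H t ζ hζ
    obtain ⟨b, rfl⟩ := exists_d_comp_eq (res I t') η hη
    exact ⟨s, hs, t', h, b ≫ T.g, by rw [← Category.assoc, hηs]⟩
  · intro H t ζ hζ
    obtain ⟨s, hs, t', h, c, hc⟩ := H t ζ hζ
    obtain ⟨b, rfl⟩ : ∃ b, b ≫ T.g = c := ⟨Projective.factorThru c T.g, Projective.factorThru_comp _ _⟩
    refine ⟨s, hs, t', h, (res I t').complex.d (k + 1) k ≫ b, ?_, ?_⟩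
    · rw [← Category.assoc, HomologicalComplex.d_comp_d, zero_comp]
    · rw [Category.assoc, hc]

end LocalCohomologyRep

namespace LocalCohomologyRep

open Opposite Limits ExtRep

variable {R : Type u} [CommRing R] {I : Ideal R} {N N' : ModuleCat.{u} R}

/-- The augmentation of the resolution of `R ⧸ I ^ t`. -/
noncomputable def aug (I : Ideal R) (t : ℕ) : (res I t).complex.X 0 ⟶ quotPow I t :=
  (res I t).π.f 0

lemma d_comp_aug (t : ℕ) : (res I t).complex.d 1 0 ≫ aug I t = 0 :=
  (res I t).complex_d_comp_π_f_zero

lemma transition_comp_aug {t t' : ℕ} (h : t ≤ t') :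
    (transition h).f 0 ≫ aug I t = aug I t' ≫ proj h :=
  ProjectiveResolution.lift_commutes_zero _ _ _

instance (t : ℕ) : Epi (aug I t) := inferInstanceAs (Epi ((res I t).π.f 0))

lemma exists_aug_comp_eq (t : ℕ) (ζ : (res I t).complex.X 0 ⟶ N)
    (hζ : (res I t).complex.d 1 0 ≫ ζ = 0) : ∃ χ : quotPow I t ⟶ N, aug I t ≫ χ = ζ :=
  ⟨(res I t).isColimitCokernelCofork.desc (CokernelCofork.ofπ ζ hζ),
    (res I t).isColimitCokernelCofork.fac (CokernelCofork.ofπ ζ hζ) WalkingParallelPair.one⟩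

/-- The class of `1` in `R ⧸ I ^ t`. -/
noncomputable def one (I : Ideal R) (t : ℕ) : quotPow I t := Submodule.Quotient.mk (1 : R)

lemma quotPow_hom_ext {t : ℕ} {χ χ' : quotPow I t ⟶ N} (h : χ (one I t) = χ' (one I t)) :
    χ = χ' := by
  ext
  exact h

/-- The map out of `R ⧸ I ^ t` given by an element that is annihilated by `I ^ t`. -/
noncomputable def torsionHom (t : ℕ) (x : N) (hx : ∀ r ∈ I ^ t, r • x = 0) : quotPow I t ⟶ N :=
  ModuleCat.ofHom (Submodule.liftQ (I ^ t) (LinearMap.toSpanSingleton R N x) hx)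

lemma torsionHom_one (t : ℕ) (x : N) (hx : ∀ r ∈ I ^ t, r • x = 0) :
    torsionHom t x hx (one I t) = x := one_smul R x

/-- The cocycle of degree zero on the resolution of `R ⧸ I ^ t` given by an element that is
annihilated by `I ^ t`. -/
noncomputable def ofTorsion (t : ℕ) (x : N) (hx : ∀ r ∈ I ^ t, r • x = 0) :
    (res I t).complex.X 0 ⟶ N :=
  aug I t ≫ torsionHom t x hx

lemma d_comp_ofTorsion (t : ℕ) (x : N) (hx : ∀ r ∈ I ^ t, r • x = 0) :
    (res I t).complex.d 1 0 ≫ ofTorsion t x hx = 0 := by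
  rw [ofTorsion, ← Category.assoc, d_comp_aug, zero_comp]

lemma exists_ofTorsion_eq (t : ℕ) (ζ : (res I t).complex.X 0 ⟶ N)
    (hζ : (res I t).complex.d 1 0 ≫ ζ = 0) :
    ∃ (x : N) (hx : ∀ r ∈ I ^ t, r • x = 0), ofTorsion t x hx = ζ := by
  obtain ⟨χ, hχ⟩ := exists_aug_comp_eq t ζ hζ
  have hx : ∀ r ∈ I ^ t, r • χ (one I t) = 0 := fun r hr => by
    have : r • one I t = 0 := by
      rw [one, ← Submodule.Quotient.mk_smul, smul_eq_mul, mul_one]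
      exact (Submodule.Quotient.mk_eq_zero _).2 hr
    rw [← map_smul, this, map_zero]
  refine ⟨χ (one I t), hx, ?_⟩
  rw [← hχ, ofTorsion]
  congr 1
  exact quotPow_hom_ext (torsionHom_one _ _ _)

lemma ofTorsion_eq_zero_iff (t : ℕ) (x : N) (hx : ∀ r ∈ I ^ t, r • x = 0) :
    ofTorsion t x hx = 0 ↔ x = 0 := by
  constructor
  · intro h
    have h0 := (cancel_epi (aug I t)).1 (h.trans comp_zero.symm)
    exact (torsionHom_one t x hx).symm.trans (ConcreteCategory.congr_hom h0 (one I t))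
  · rintro rfl
    have : torsionHom t (0 : N) hx = 0 := quotPow_hom_ext (torsionHom_one _ _ _)
    rw [ofTorsion, this, comp_zero]

lemma transition_comp_ofTorsion {t t' : ℕ} (h : t ≤ t') (x : N) (hx : ∀ r ∈ I ^ t, r • x = 0)
    (hx' : ∀ r ∈ I ^ t', r • x = 0) :
    (transition h).f 0 ≫ ofTorsion t x hx = ofTorsion t' x hx' := by
  rw [ofTorsion, ← Category.assoc, transition_comp_aug, Category.assoc, ofTorsion]
  congr 1
  exact quotPow_hom_ext ((torsionHom_one t x hx).trans (torsionHom_one _ _ _).symm)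

lemma smul_ofTorsion (s : R) (t : ℕ) (x : N) (hx : ∀ r ∈ I ^ t, r • x = 0)
    (hx' : ∀ r ∈ I ^ t, r • s • x = 0) :
    s • ofTorsion t x hx = ofTorsion t (s • x) hx' := by
  rw [ofTorsion, ofTorsion, ← Linear.comp_smul]
  congr 1
  exact quotPow_hom_ext ((congrArg (s • ·) (torsionHom_one t x hx)).trans
    (torsionHom_one _ _ _).symm)

lemma ofTorsion_comp (ψ : N ⟶ N') (t : ℕ) (x : N) (hx : ∀ r ∈ I ^ t, r • x = 0)
    (hx' : ∀ r ∈ I ^ t, r • ψ x = 0) :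
    ofTorsion t x hx ≫ ψ = ofTorsion t (ψ x) hx' := by
  rw [ofTorsion, ofTorsion, Category.assoc]
  congr 1
  exact quotPow_hom_ext ((congrArg ψ (torsionHom_one t x hx)).trans (torsionHom_one _ _ _).symm)

lemma ofTorsion_injective {t : ℕ} {x y : N} {hx : ∀ r ∈ I ^ t, r • x = 0}
    {hy : ∀ r ∈ I ^ t, r • y = 0} (h : ofTorsion t x hx = ofTorsion t y hy) : x = y := by
  have h0 := (cancel_epi (aug I t)).1 h
  exact (torsionHom_one t x hx).symm.trans
    ((ConcreteCategory.congr_hom h0 (one I t)).trans (torsionHom_one t y hy))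

lemma pow_smul_eq_zero {t t' : ℕ} (h : t ≤ t') {x : N} (hx : ∀ r ∈ I ^ t, r • x = 0) :
    ∀ r ∈ I ^ t', r • x = 0 := fun r hr => hx r (Ideal.pow_le_pow_right h hr)

lemma smul_smul_eq_zero {t : ℕ} {x : N} (hx : ∀ r ∈ I ^ t, r • x = 0) (s : R) :
    ∀ r ∈ I ^ t, r • s • x = 0 := fun r hr => by rw [smul_comm, hx r hr, smul_zero]

lemma apply_smul_eq_zero (ψ : N ⟶ N') {t : ℕ} {x : N} (hx : ∀ r ∈ I ^ t, r • x = 0) :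
    ∀ r ∈ I ^ t, r • ψ x = 0 := fun r hr => by rw [← map_smul, hx r hr, map_zero]

/-- An element is torsion with respect to the ideal `I` if it is annihilated by a power of `I`. -/
def IsTorsion (I : Ideal R) (x : N) : Prop := ∃ n : ℕ, ∀ r ∈ I ^ n, r • x = 0

lemma vanishExt_zero_iff (S : Submonoid R) (M : ModuleCat.{u} R) :
    VanishExt I S 0 M ↔ ∀ x : M, IsTorsion I x → ∃ s ∈ S, s • x = 0 := by
  constructor
  · rintro H x ⟨t, hx⟩
    obtain ⟨s, hs, t', h, h0⟩ := H t _ (d_comp_ofTorsion t x hx)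
    rw [transition_comp_ofTorsion h x hx (pow_smul_eq_zero h hx),
      smul_ofTorsion s t' x _ (smul_smul_eq_zero (pow_smul_eq_zero h hx) s)] at h0
    exact ⟨s, hs, (ofTorsion_eq_zero_iff _ _ _).1 h0⟩
  · intro H t φ hφ
    obtain ⟨x, hx, rfl⟩ := exists_ofTorsion_eq t φ hφ
    obtain ⟨s, hs, h0⟩ := H x ⟨t, hx⟩
    refine ⟨s, hs, t, le_rfl, ?_⟩
    rw [transition_comp_ofTorsion le_rfl x hx hx, smul_ofTorsion s t x _ (smul_smul_eq_zero hx s)]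
    exact (ofTorsion_eq_zero_iff _ _ _).2 h0

lemma liftExt_zero_iff (S : Submonoid R) {E Q : ModuleCat.{u} R} (ψ : E ⟶ Q) :
    LiftExt I S 0 ψ ↔ ∀ x : Q, IsTorsion I x → ∃ s ∈ S, ∃ y : E, IsTorsion I y ∧ ψ y = s • x := by
  constructor
  · rintro H x ⟨t, hx⟩
    obtain ⟨s, hs, t', h, η, hη, h0⟩ := H t _ (d_comp_ofTorsion t x hx)
    obtain ⟨y, hy, rfl⟩ := exists_ofTorsion_eq t' η hη
    rw [transition_comp_ofTorsion h x hx (pow_smul_eq_zero h hx),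
      smul_ofTorsion s t' x _ (smul_smul_eq_zero (pow_smul_eq_zero h hx) s),
      ofTorsion_comp ψ t' y hy (apply_smul_eq_zero ψ hy)] at h0
    exact ⟨s, hs, y, ⟨t', hy⟩, ofTorsion_injective h0⟩
  · intro H t φ hφ
    obtain ⟨x, hx, rfl⟩ := exists_ofTorsion_eq t φ hφ
    obtain ⟨s, hs, y, ⟨m, hy⟩, h0⟩ := H x ⟨t, hx⟩
    have hy' := pow_smul_eq_zero (le_max_right t m) hy
    have hx' := pow_smul_eq_zero (le_max_left t m) hx
    refine ⟨s, hs, max t m, le_max_left _ _, ofTorsion _ y hy', d_comp_ofTorsion _ y hy', ?_⟩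
    rw [transition_comp_ofTorsion _ x hx hx', smul_ofTorsion s _ x _ (smul_smul_eq_zero hx' s),
      ofTorsion_comp ψ _ y hy' (apply_smul_eq_zero ψ hy')]
    congr 1

end LocalCohomologyRep

namespace Cech

variable {R : Type u} [CommRing R] {ι : Type} (f : ι → R) (S : Submonoid R)

/-- After localization at `S`, the Čech cohomology of degree `k` with values in `M` vanishes. -/
def Vanish (k : ℕ) (M : ModuleCat.{u} R) : Prop :=
  ∀ z ∈ cocycles f k M, ∃ s ∈ S, s • z ∈ coboundaries f k M

/-- After localization at `S`, the Čech cocycles of degree `k` with values in `Q` lift to cocycles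
with values in `E`. -/
def Lift (k : ℕ) {E Q : ModuleCat.{u} R} (ψ : E →ₗ[R] Q) : Prop :=
  ∀ z ∈ cocycles f k Q, ∃ s ∈ S, ∃ y ∈ cocycles f k E, map f k ψ y = s • z

variable {f} {M E Q : ModuleCat.{u} R} {φ : M →ₗ[R] E} {ψ : E →ₗ[R] Q}

/-- Dimension shifting for Čech cocycles, parallel to `LocalCohomologyRep.vanishExt_succ_iff`. -/
lemma vanish_succ_iff (hE : Acyclic f E) (hφ : Function.Injective φ) (hψ : Function.Surjective ψ)
    (h : Function.Exact φ ψ) (k : ℕ) : Vanish f S (k + 1) M ↔ Lift f S k ψ := by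
  constructor
  · intro H z hz
    obtain ⟨b, rfl⟩ := map_surjective k ψ hψ z
    obtain ⟨a, ha⟩ := (map_exact (k + 1) φ ψ h (d f k E b)).1 (by rw [map_d, mem_cocycles.1 hz])
    obtain ⟨s, hs, a', ha'⟩ := H a (mem_cocycles.2 (map_injective (k + 2) φ hφ (by
      rw [map_d, ha, d_d, map_zero])))
    refine ⟨s, hs, s • b - map f k φ a', mem_cocycles.2 ?_, ?_⟩
    · rw [map_sub, ← map_d, ha', map_smul, map_smul, ha, sub_self]
    · rw [map_sub, map_smul, (map_exact k φ ψ h _).2 ⟨a', rfl⟩, sub_zero]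
  · intro H a ha
    obtain ⟨b, hb⟩ := hE k (map_mem_cocycles φ ha)
    obtain ⟨s, hs, y, hy, hys⟩ := H (map f k ψ b) (mem_cocycles.2 (by
      rw [← map_d, hb, (map_exact (k + 1) φ ψ h _).2 ⟨a, rfl⟩]))
    obtain ⟨a', ha'⟩ := (map_exact k φ ψ h (s • b - y)).1 (by
      rw [map_sub, map_smul, hys, sub_self])
    refine ⟨s, hs, a', map_injective (k + 1) φ hφ ?_⟩
    rw [map_d, ha', map_sub, map_smul, hb, mem_cocycles.1 hy, sub_zero, map_smul]

/-- The counterpart of `LocalCohomologyRep.liftExt_succ_iff` for Čech cocycles. -/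
lemma lift_succ_iff (hE : Acyclic f E) (hψ : Function.Surjective ψ) (k : ℕ) :
    Lift f S (k + 1) ψ ↔ Vanish f S (k + 1) Q := by
  constructor
  · intro H z hz
    obtain ⟨s, hs, y, hy, hys⟩ := H z hz
    obtain ⟨b, rfl⟩ := hE k hy
    exact ⟨s, hs, map f k ψ b, by rw [← map_d, hys]⟩
  · intro H z hz
    obtain ⟨s, hs, c, hc⟩ := H z hz
    obtain ⟨b, rfl⟩ := map_surjective k ψ hψ c
    exact ⟨s, hs, d f k E b, d_d k E b, by rw [map_d, hc]⟩

open LocalCohomologyRep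

variable [Finite ι]

lemma vanish_zero_iff : Vanish f S 0 M ↔
    ∀ x : M, IsTorsion (Ideal.span (Set.range f)) x → ∃ s ∈ S, s • x = 0 :=
  forall_congr' fun x => imp_congr (mem_cocycles_zero_iff x) Iff.rfl

lemma lift_zero_iff : Lift f S 0 ψ ↔ ∀ x : Q, IsTorsion (Ideal.span (Set.range f)) x →
    ∃ s ∈ S, ∃ y : E, IsTorsion (Ideal.span (Set.range f)) y ∧ ψ y = s • x :=
  forall_congr' fun x => imp_congr (mem_cocycles_zero_iff x) (exists_congr fun _ =>
    and_congr Iff.rfl (exists_congr fun y => and_congr (mem_cocycles_zero_iff y) Iff.rfl))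

/-- The Čech complex computes local cohomology, in the form that is needed for the comparison of
supports: the localizations at `S` vanish simultaneously. Both sides satisfy the same dimension
shifting along an embedding into an injective module, and they agree in degree zero. -/
theorem vanishExt_iff_vanish [IsNoetherianRing R] (k : ℕ) : ∀ M : ModuleCat.{u} R,
    VanishExt (Ideal.span (Set.range f)) S k M ↔ Vanish f S k M := by
  have : Fintype ι := Fintype.ofFinite ι
  have key : ∀ M : ModuleCat.{u} R, ∃ T : ShortComplex (ModuleCat.{u} R), T.ShortExact ∧
      T.X₁ = M ∧ Injective T.X₂ ∧ Acyclic f T.X₂ := fun M => by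
    let T : ShortComplex (ModuleCat.{u} R) :=
      ShortComplex.mk (Injective.ι M) (Limits.cokernel.π (Injective.ι M)) (by simp)
    have hT : T.ShortExact :=
      { exact := ShortComplex.exact_of_g_is_cokernel _ (Limits.cokernelIsCokernel _)
        mono_f := inferInstanceAs (Mono (Injective.ι M))
        epi_g := inferInstanceAs (Epi (Limits.cokernel.π (Injective.ι M))) }
    have hinj : Injective T.X₂ := inferInstanceAs (Injective (Injective.under M))
    have : Injective (ModuleCat.of R T.X₂) := hinj
    have : Module.Injective R T.X₂ := Module.injective_module_of_injective_object R T.X₂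
    exact ⟨T, hT, rfl, hinj, acyclic_of_baer (Module.Baer.of_injective this)⟩
  cases k with
  | zero => exact fun M => (vanishExt_zero_iff S M).trans (vanish_zero_iff S).symm
  | succ k =>
    induction k with
    | zero =>
      intro M
      obtain ⟨T, hT, rfl, hinj, hac⟩ := key M
      have hex : Function.Exact T.f.hom T.g.hom :=
        (ShortComplex.ShortExact.moduleCat_exact_iff_function_exact _).1 hT.exact
      rw [vanishExt_succ_iff hT S, vanish_succ_iff S hac hT.moduleCat_injective_f
        hT.moduleCat_surjective_g hex, liftExt_zero_iff,
        lift_zero_iff]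
    | succ k ih =>
      intro M
      obtain ⟨T, hT, rfl, hinj, hac⟩ := key M
      have hex : Function.Exact T.f.hom T.g.hom :=
        (ShortComplex.ShortExact.moduleCat_exact_iff_function_exact _).1 hT.exact
      rw [vanishExt_succ_iff hT S, vanish_succ_iff S hac hT.moduleCat_injective_f
        hT.moduleCat_surjective_g hex, liftExt_succ_iff hT,
        lift_succ_iff S hac hT.moduleCat_surjective_g, ih]

end Cech

/-! ### Supports of local cohomology of a hypersurface -/

/-- The endomorphisms of `A` that are sums of endomorphisms that factor through some member of the
family `N`. The identity belongs to it if and only if `A` is a direct summand of a finite direct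
sum of members of the family. -/
def traceEnd {R : Type*} [CommRing R] {κ : Type*} (N : κ → Type*) [∀ b, AddCommGroup (N b)]
    [∀ b, Module R (N b)] (A : Type*) [AddCommGroup A] [Module R A] : Submodule R (A →ₗ[R] A) :=
  Submodule.span R {θ | ∃ (b : κ) (α : A →ₗ[R] N b) (β : N b →ₗ[R] A), θ = β ∘ₗ α}

/-- For a finitely generated submodule `U`, the primes at which `U` is locally contained in `V`
form the complement of the support of `U / (U ∩ V)`. -/
lemma PrimeSpectrum.isOpen_forall_exists_smul_mem {R M : Type*} [CommRing R] [AddCommGroup M]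
    [Module R M] (U V : Submodule R M) [Module.Finite R U] :
    IsOpen {P : PrimeSpectrum R | ∀ u ∈ U, ∃ s ∈ P.asIdeal.primeCompl, s • u ∈ V} := by
  have h : {P : PrimeSpectrum R | ∀ u ∈ U, ∃ s ∈ P.asIdeal.primeCompl, s • u ∈ V} =
      (Module.support R (U ⧸ V.comap U.subtype))ᶜ := by
    ext P
    rw [Set.mem_compl_iff, Module.notMem_support_iff']
    constructor
    · intro H x
      obtain ⟨u, rfl⟩ := Submodule.Quotient.mk_surjective _ x
      obtain ⟨s, hs, h⟩ := H u u.2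
      exact ⟨s, hs, (Submodule.Quotient.mk_eq_zero _).2 h⟩
    · intro H u hu
      obtain ⟨s, hs, h⟩ := H (Submodule.Quotient.mk ⟨u, hu⟩)
      rw [← Submodule.Quotient.mk_smul, Submodule.Quotient.mk_eq_zero] at h
      exact ⟨s, hs, h⟩
  rw [h, isOpen_compl_iff]
  exact Module.isClosed_support

namespace Cech

variable {R : Type u} [CommRing R] {ι : Type} (f : ι → R) (g : R) (k : ℕ)

/-- The cocycles with denominators `f i`. -/
noncomputable def source₁ (M : ModuleCat.{u} R) : Submodule R (cochain f k M) :=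
  cocycles f k M ⊓ bounded f 1 k M

/-- The cocycles whose class in Čech cohomology is divisible by `g`. -/
noncomputable def target₁ (M : ModuleCat.{u} R) : Submodule R (cochain f k M) :=
  (cocycles f k M).map (g • LinearMap.id) ⊔ coboundaries f k M

/-- The cocycles with denominators `f i` whose class in Čech cohomology is annihilated by `g`. -/
noncomputable def source₂ (M : ModuleCat.{u} R) : Submodule R (cochain f k M) :=
  source₁ f k M ⊓ (coboundaries f k M).comap (g • LinearMap.id)

variable {f g k} {M N : ModuleCat.{u} R}

lemma mem_target₁ {x : cochain f k M} : x ∈ target₁ f g k M ↔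
    ∃ w ∈ cocycles f k M, ∃ c ∈ coboundaries f k M, x = g • w + c := by
  rw [target₁, Submodule.mem_sup]
  constructor
  · rintro ⟨_, ⟨w, hw, rfl⟩, c, hc, rfl⟩
    exact ⟨w, hw, c, hc, rfl⟩
  · rintro ⟨w, hw, c, hc, rfl⟩
    exact ⟨_, ⟨w, hw, rfl⟩, c, hc, rfl⟩

lemma mem_source₂ {x : cochain f k M} : x ∈ source₂ f g k M ↔
    x ∈ source₁ f k M ∧ g • x ∈ coboundaries f k M := Iff.rfl

lemma map_mem_source₁ (φ : M →ₗ[R] N) {x : cochain f k M} (hx : x ∈ source₁ f k M) :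
    map f k φ x ∈ source₁ f k N :=
  ⟨map_mem_cocycles φ hx.1, map_mem_bounded 1 k φ hx.2⟩

lemma map_mem_target₁ (φ : M →ₗ[R] N) {x : cochain f k M} (hx : x ∈ target₁ f g k M) :
    map f k φ x ∈ target₁ f g k N := by
  obtain ⟨w, hw, c, hc, rfl⟩ := mem_target₁.1 hx
  exact mem_target₁.2 ⟨_, map_mem_cocycles φ hw, _, map_mem_coboundaries φ hc, by
    rw [map_add, map_smul]⟩

lemma map_mem_source₂ (φ : M →ₗ[R] N) {x : cochain f k M} (hx : x ∈ source₂ f g k M) :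
    map f k φ x ∈ source₂ f g k N :=
  ⟨map_mem_source₁ φ hx.1, by
    change g • map f k φ x ∈ coboundaries f k N
    rw [← map_smul]
    exact map_mem_coboundaries φ hx.2⟩

/-- If `A` is a direct summand of a finite direct sum of modules `N b`, then functorial families of
submodules of cochains that agree, after localization, on all `N b` also agree on `A`. -/
lemma exists_smul_mem_of_traceEnd {κ : Type*} {N : κ → ModuleCat.{u} R} {A : ModuleCat.{u} R}
    (hA : LinearMap.id ∈ traceEnd (R := R) (fun b => N b) A)
    (U V : ∀ M : ModuleCat.{u} R, Submodule R (cochain f k M))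
    (hU : ∀ {M N : ModuleCat.{u} R} (φ : M →ₗ[R] N) {x}, x ∈ U M → map f k φ x ∈ U N)
    (hV : ∀ {M N : ModuleCat.{u} R} (φ : M →ₗ[R] N) {x}, x ∈ V M → map f k φ x ∈ V N)
    (S : Submonoid R) (h : ∀ b, ∀ u ∈ U (N b), ∃ s ∈ S, s • u ∈ V (N b)) :
    ∀ u ∈ U A, ∃ s ∈ S, s • u ∈ V A := by
  intro u hu
  suffices H : ∀ θ ∈ traceEnd (R := R) (fun b => N b) A, ∃ s ∈ S, s • map f k θ u ∈ V A by
    have := H _ hA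
    rwa [map_id] at this
  intro θ hθ
  induction hθ using Submodule.span_induction with
  | mem θ hθ =>
    obtain ⟨b, α, β, rfl⟩ := hθ
    obtain ⟨s, hs, hsu⟩ := h b _ (hU α hu)
    refine ⟨s, hs, ?_⟩
    rw [← map_map, ← map_smul]
    exact hV β hsu
  | zero => exact ⟨1, S.one_mem, by rw [map_zero, LinearMap.zero_apply, smul_zero]; exact zero_mem _⟩
  | add θ θ' _ _ h h' =>
    obtain ⟨s, hs, h⟩ := h
    obtain ⟨s', hs', h'⟩ := h'
    refine ⟨s * s', S.mul_mem hs hs', ?_⟩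
    rw [map_add, LinearMap.add_apply, smul_add]
    refine add_mem ?_ ?_
    · rw [mul_comm, mul_smul]
      exact Submodule.smul_mem _ _ h
    · rw [mul_smul]
      exact Submodule.smul_mem _ _ h'
  | smul r θ _ h =>
    obtain ⟨s, hs, h⟩ := h
    refine ⟨s, hs, ?_⟩
    rw [map_smul, LinearMap.smul_apply, smul_comm]
    exact Submodule.smul_mem _ _ h

/-- The long exact sequence of Čech cohomology for multiplication by a nonzerodivisor `g`: after
localization, the cohomology of `Q = M / g M` vanishes if and only if `g` acts surjectively on the
cohomology of `M` and injectively on the cohomology of `M` in the next degree. -/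
lemma vanish_iff_of_exact (S : Submonoid R) {Q : ModuleCat.{u} R} (ψ : M →ₗ[R] Q)
    (hg : Function.Injective fun m : M => g • m) (hψ : Function.Surjective ψ)
    (hex : Function.Exact (g • LinearMap.id : M →ₗ[R] M) ψ) :
    Vanish f S k Q ↔ (∀ z ∈ cocycles f k M, ∃ s ∈ S, s • z ∈ target₁ f g k M) ∧
      (∀ z ∈ cocycles f (k + 1) M, g • z ∈ coboundaries f (k + 1) M →
        ∃ s ∈ S, s • z ∈ coboundaries f (k + 1) M) := by
  have hinj : ∀ l, Function.Injective fun c : cochain f l M => g • c := fun l => by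
    have := map_injective (f := f) l (g • LinearMap.id : M →ₗ[R] M) hg
    rwa [map_smul_id] at this
  have hexact : ∀ l (c : cochain f l M), map f l ψ c = 0 ↔ ∃ b, g • b = c := fun l c => by
    have := map_exact (f := f) l _ ψ hex c
    rwa [map_smul_id] at this
  -- coboundaries lift along `ψ`
  have hbound : ∀ (l : ℕ) (c : cochain f l M), map f l ψ c ∈ coboundaries f l Q →
      ∃ b, ∃ c' ∈ coboundaries f l M, c = g • b + c' := fun l c hc => by
    cases l with
    | zero =>
      obtain ⟨b, hb⟩ := (hexact 0 c).1 hc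
      exact ⟨b, 0, zero_mem _, by rw [hb, add_zero]⟩
    | succ l =>
      obtain ⟨b, hb⟩ := hc
      obtain ⟨b, rfl⟩ := map_surjective l ψ hψ b
      obtain ⟨a, ha⟩ := (hexact (l + 1) (c - d f l M b)).1 (by rw [map_sub, map_d, hb, sub_self])
      exact ⟨a, _, ⟨b, rfl⟩, by rw [ha, sub_add_cancel]⟩
  constructor
  · intro H
    constructor
    · intro z hz
      obtain ⟨s, hs, hsz⟩ := H _ (map_mem_cocycles ψ hz)
      rw [← map_smul] at hsz
      obtain ⟨b, c, hc, hbc⟩ := hbound k _ hsz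
      refine ⟨s, hs, mem_target₁.2 ⟨b, ?_, c, hc, hbc⟩⟩
      refine mem_cocycles.2 (hinj (k + 1) ?_)
      change g • d f k M b = g • (0 : cochain f (k + 1) M)
      rw [← map_smul, eq_sub_of_add_eq hbc.symm, map_sub, map_smul, mem_cocycles.1 hz,
        mem_cocycles.1 (coboundaries_le_cocycles k M hc), smul_zero, sub_zero, smul_zero]
    · rintro w - ⟨c, hc⟩
      obtain ⟨s, hs, hsc⟩ := H (map f k ψ c) (mem_cocycles.2 (by
        rw [← map_d, hc]; exact (hexact _ _).2 ⟨w, rfl⟩))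
      rw [← map_smul] at hsc
      obtain ⟨b, c', hc', hbc⟩ := hbound k _ hsc
      refine ⟨s, hs, b, hinj (k + 1) ?_⟩
      change g • d f k M b = g • s • w
      rw [← map_smul, eq_sub_of_add_eq hbc.symm, map_sub, map_smul, hc,
        mem_cocycles.1 (coboundaries_le_cocycles k M hc'), sub_zero, smul_comm]
  · rintro ⟨H₁, H₂⟩ z hz
    obtain ⟨c, rfl⟩ := map_surjective k ψ hψ z
    obtain ⟨w, hw⟩ := (hexact (k + 1) (d f k M c)).1 (by rw [map_d, mem_cocycles.1 hz])
    obtain ⟨s, hs, b, hb⟩ := H₂ w (mem_cocycles.2 (hinj (k + 2) (by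
      change g • d f (k + 1) M w = g • (0 : cochain f (k + 2) M)
      rw [← map_smul, hw, d_d, smul_zero]))) ⟨c, hw.symm⟩
    obtain ⟨s', hs', h⟩ := H₁ (s • c - g • b) (mem_cocycles.2 (by
      rw [map_sub, map_smul, map_smul, hb, ← hw, smul_comm, sub_self]))
    obtain ⟨w', -, c', hc', h⟩ := mem_target₁.1 h
    refine ⟨s' * s, S.mul_mem hs' hs, ?_⟩
    have : (s' * s) • c = g • (w' + s' • b) + c' := by
      rw [mul_smul, smul_add, add_right_comm, ← h, smul_sub, smul_comm g s' b, sub_add_cancel]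
    rw [← map_smul, this, map_add, (hexact k _).2 ⟨_, rfl⟩, zero_add]
    exact map_mem_coboundaries ψ hc'

section Frobenius

variable {F : R →+* R} {q : ℕ} (hF : ∀ a, F a = a ^ q) (hq : q ≠ 0) (S : Submonoid R)

include hF hq

/-- If `g`, and hence `g ^ q`, acts surjectively on the localized cohomology of `M`, then `g` acts
surjectively on that of the restriction of scalars of `M`, where `g` acts as `g ^ q` does on `M`. -/
lemma exists_smul_mem_target₁_restrict
    (H : ∀ z ∈ cocycles f k M, ∃ s ∈ S, s • z ∈ target₁ f g k M) :
    ∀ z ∈ source₁ f k ((ModuleCat.restrictScalars F).obj M),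
      ∃ s ∈ S, s • z ∈ target₁ f g k ((ModuleCat.restrictScalars F).obj M) := by
  -- divisibility by `g` in all cohomology classes can be iterated
  have hiter : ∀ n : ℕ, ∀ z ∈ cocycles f k M, ∃ s ∈ S, ∃ w ∈ cocycles f k M,
      ∃ c ∈ coboundaries f k M, s • z = g ^ n • w + c := by
    intro n
    induction n with
    | zero => exact fun z hz => ⟨1, S.one_mem, z, hz, 0, zero_mem _, by simp⟩
    | succ n ih =>
      intro z hz
      obtain ⟨s, hs, w, hw, c, hc, h⟩ := ih z hz
      obtain ⟨s', hs', h'⟩ := H w hw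
      obtain ⟨w', hw', c', hc', h'⟩ := mem_target₁.1 h'
      refine ⟨s' * s, S.mul_mem hs' hs, w', hw', g ^ n • c' + s' • c,
        add_mem (Submodule.smul_mem _ _ hc') (Submodule.smul_mem _ _ hc), ?_⟩
      rw [mul_smul, h, smul_add, smul_comm s', h', smul_add, smul_smul, ← pow_succ, add_assoc]
  intro z hz
  obtain ⟨s, hs, w, hw, c, hc, h⟩ := hiter q _ ((theta_mem_cocycles hF hq).2 hz.1)
  obtain ⟨w, rfl⟩ := (theta_bijective hF hq k M).2 w
  obtain ⟨c, rfl⟩ := (theta_bijective hF hq k M).2 c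
  rw [theta_mem_cocycles] at hw
  rw [theta_mem_coboundaries] at hc
  refine ⟨s, hs, ?_⟩
  obtain ⟨m, rfl⟩ := Nat.exists_eq_succ_of_ne_zero hq
  obtain ⟨w', hw'⟩ := (theta_bijective hF hq k M).2 (s ^ m • theta f hF hq k M w)
  obtain ⟨c', hc'⟩ := (theta_bijective hF hq k M).2 (s ^ m • theta f hF hq k M c)
  refine mem_target₁.2 ⟨w', ?_, c', ?_, (theta_bijective hF hq k M).1 ?_⟩
  · rw [← theta_mem_cocycles hF hq, hw']
    exact Submodule.smul_mem _ _ ((theta_mem_cocycles hF hq).2 hw)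
  · rw [← theta_mem_coboundaries hF hq, hc']
    exact Submodule.smul_mem _ _ ((theta_mem_coboundaries hF hq).2 hc)
  · rw [map_add, LinearMap.map_smulₛₗ, LinearMap.map_smulₛₗ, hw', hc', hF, hF,
      pow_succ s m, mul_smul, h, smul_add, smul_comm (s ^ m)]

/-- If `g`, and hence `g ^ q`, acts injectively on the localized cohomology of `M`, then `g` acts
injectively on that of the restriction of scalars of `M`. -/
lemma exists_smul_mem_coboundaries_restrict
    (H : ∀ z ∈ cocycles f k M, g • z ∈ coboundaries f k M → ∃ s ∈ S, s • z ∈ coboundaries f k M) :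
    ∀ z ∈ source₂ f g k ((ModuleCat.restrictScalars F).obj M),
      ∃ s ∈ S, s • z ∈ coboundaries f k ((ModuleCat.restrictScalars F).obj M) := by
  -- injectivity of the action of `g` on cohomology can be iterated
  have hiter : ∀ n : ℕ, ∀ z ∈ cocycles f k M, g ^ n • z ∈ coboundaries f k M →
      ∃ s ∈ S, s • z ∈ coboundaries f k M := by
    intro n
    induction n with
    | zero => exact fun z _ h => ⟨1, S.one_mem, by simpa using h⟩
    | succ n ih =>
      intro z hz h
      rw [pow_succ, mul_smul] at h
      obtain ⟨s, hs, h⟩ := ih (g • z) (Submodule.smul_mem _ _ hz) h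
      rw [smul_comm] at h
      obtain ⟨s', hs', h'⟩ := H (s • z) (Submodule.smul_mem _ _ hz) h
      exact ⟨s' * s, S.mul_mem hs' hs, by rwa [mul_smul]⟩
  rintro z ⟨hz, hgz⟩
  replace hgz : g • z ∈ coboundaries f k ((ModuleCat.restrictScalars F).obj M) := hgz
  rw [← theta_mem_coboundaries hF hq, LinearMap.map_smulₛₗ, hF] at hgz
  obtain ⟨s, hs, h⟩ := hiter q _ ((theta_mem_cocycles hF hq).2 hz.1) hgz
  refine ⟨s, hs, ?_⟩
  obtain ⟨m, rfl⟩ := Nat.exists_eq_succ_of_ne_zero hq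
  rw [← theta_mem_coboundaries hF hq, LinearMap.map_smulₛₗ, hF, pow_succ, mul_smul]
  exact Submodule.smul_mem _ _ h

/-- A cocycle with denominators `f i ^ q` comes from a cocycle with denominators `f i` on the
restriction of scalars along the power map. -/
lemma exists_theta_eq {z : cochain f k M} (hz : z ∈ cocycles f k M) (hb : z ∈ bounded f q k M) :
    ∃ y ∈ source₁ f k ((ModuleCat.restrictScalars F).obj M), theta f hF hq k M y = z := by
  obtain ⟨y, rfl⟩ := (theta_bijective hF hq k M).2 z
  exact ⟨y, ⟨(theta_mem_cocycles hF hq).1 hz, mem_bounded_of_theta hF hq k hb⟩, rfl⟩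

/-- A class on `M` that is divisible by `g` after restriction of scalars is divisible by `g ^ q`, hence
by `g`. -/
lemma exists_smul_mem_target₁_of_restrict
    (H : ∀ z ∈ source₁ f k ((ModuleCat.restrictScalars F).obj M),
      ∃ s ∈ S, s • z ∈ target₁ f g k ((ModuleCat.restrictScalars F).obj M))
    {z : cochain f k M} (hz : z ∈ cocycles f k M) (hb : z ∈ bounded f q k M) :
    ∃ s ∈ S, s • z ∈ target₁ f g k M := by
  obtain ⟨y, hy, rfl⟩ := exists_theta_eq hF hq hz hb
  obtain ⟨s, hs, h⟩ := H y hy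
  obtain ⟨w, hw, c, hc, h⟩ := mem_target₁.1 h
  obtain ⟨m, rfl⟩ := Nat.exists_eq_succ_of_ne_zero hq
  refine ⟨s ^ (m + 1), S.pow_mem hs _, mem_target₁.2 ⟨g ^ m • theta f hF hq k M w,
    Submodule.smul_mem _ _ ((theta_mem_cocycles hF hq).2 hw), theta f hF hq k M c,
    (theta_mem_coboundaries hF hq).2 hc, ?_⟩⟩
  rw [← hF, ← LinearMap.map_smulₛₗ, h, map_add, LinearMap.map_smulₛₗ, hF, pow_succ', mul_smul]

/-- A class on `M` that is annihilated by `g` is annihilated by `g ^ q`, hence by `g` after restriction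
of scalars. -/
lemma exists_smul_mem_coboundaries_of_restrict
    (H : ∀ z ∈ source₂ f g k ((ModuleCat.restrictScalars F).obj M),
      ∃ s ∈ S, s • z ∈ coboundaries f k ((ModuleCat.restrictScalars F).obj M))
    {z : cochain f k M} (hz : z ∈ cocycles f k M) (hb : z ∈ bounded f q k M)
    (hgz : g • z ∈ coboundaries f k M) :
    ∃ s ∈ S, s • z ∈ coboundaries f k M := by
  obtain ⟨y, hy, rfl⟩ := exists_theta_eq hF hq hz hb
  obtain ⟨m, rfl⟩ := Nat.exists_eq_succ_of_ne_zero hq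
  obtain ⟨s, hs, h⟩ := H y (mem_source₂.2 ⟨hy, by
    rw [← theta_mem_coboundaries hF hq, LinearMap.map_smulₛₗ, hF, pow_succ, mul_smul]
    exact Submodule.smul_mem _ _ hgz⟩)
  refine ⟨s ^ (m + 1), S.pow_mem hs _, ?_⟩
  rw [← hF, ← LinearMap.map_smulₛₗ]
  exact (theta_mem_coboundaries hF hq).2 h

end Frobenius

end Cech

/-! ### Flat descent of direct summands -/

section TraceEnd

open TensorProduct

variable {R : Type*} [CommRing R] {κ : Type*} {N : κ → Type*} [∀ b, AddCommGroup (N b)]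
  [∀ b, Module R (N b)] {A : Type*} [AddCommGroup A] [Module R A]

lemma comp_mem_traceEnd (b : κ) (α : A →ₗ[R] N b) (β : N b →ₗ[R] A) :
    β ∘ₗ α ∈ traceEnd N A :=
  Submodule.subset_span ⟨b, α, β, rfl⟩

lemma comp_comp_mem_traceEnd {B : Type*} [AddCommGroup B] [Module R B] {θ : B →ₗ[R] B}
    (hθ : θ ∈ traceEnd N B) (α : A →ₗ[R] B) (β : B →ₗ[R] A) : β ∘ₗ θ ∘ₗ α ∈ traceEnd N A := by
  induction hθ using Submodule.span_induction with
  | mem θ hθ =>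
    obtain ⟨b, γ, δ, rfl⟩ := hθ
    exact comp_mem_traceEnd b (γ ∘ₗ α) (β ∘ₗ δ)
  | zero => simp only [LinearMap.zero_comp, LinearMap.comp_zero, zero_mem]
  | add θ θ' _ _ h h' => rw [LinearMap.add_comp, LinearMap.comp_add]; exact add_mem h h'
  | smul r θ _ h => rw [LinearMap.smul_comp, LinearMap.comp_smul]; exact Submodule.smul_mem _ r h

lemma id_mem_traceEnd_trans {κ' : Type*} {N' : κ' → Type*} [∀ b, AddCommGroup (N' b)]
    [∀ b, Module R (N' b)] (h : ∀ b, LinearMap.id ∈ traceEnd (R := R) N' (N b))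
    (hA : LinearMap.id ∈ traceEnd (R := R) N A) : LinearMap.id ∈ traceEnd (R := R) N' A := by
  refine (Submodule.span_le (p := traceEnd N' A)).2 ?_ hA
  rintro _ ⟨b, α, β, rfl⟩
  exact comp_comp_mem_traceEnd (h b) α β

lemma id_mem_traceEnd_self (b : κ) : LinearMap.id ∈ traceEnd (R := R) N (N b) :=
  comp_mem_traceEnd b LinearMap.id LinearMap.id

lemma id_mem_traceEnd_of_linearEquiv {N' : κ → Type*} [∀ b, AddCommGroup (N' b)]
    [∀ b, Module R (N' b)] {A' : Type*} [AddCommGroup A'] [Module R A']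
    (e : ∀ b, N b ≃ₗ[R] N' b) (e' : A ≃ₗ[R] A') (h : LinearMap.id ∈ traceEnd (R := R) N A) :
    LinearMap.id ∈ traceEnd (R := R) N' A' := by
  have h₁ : LinearMap.id ∈ traceEnd (R := R) N' A := by
    refine id_mem_traceEnd_trans (fun b => ?_) h
    have := comp_mem_traceEnd (N := N') b (e b).toLinearMap (e b).symm.toLinearMap
    rwa [LinearEquiv.symm_comp] at this
  have := comp_comp_mem_traceEnd h₁ e'.symm.toLinearMap e'.toLinearMap
  rwa [LinearMap.id_comp, LinearEquiv.comp_symm] at this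

/-- Being a direct summand of a finite direct sum of modules `N b` descends along a flat ring
homomorphism `R → T`, up to an element `r` of `R` that lies outside of a given ideal `P` with
`P T ≠ T`. -/
lemma exists_smul_id_mem_traceEnd_of_flat (T : Type*) [CommRing T] [Algebra R T]
    [Module.Flat R T] [Module.FinitePresentation R A] [∀ b, Module.FinitePresentation R (N b)]
    (h : LinearMap.id ∈ traceEnd (R := T) (fun b => T ⊗[R] N b) (T ⊗[R] A))
    {k : Type*} [CommRing k] [Nontrivial k] (ψ : T →+* k) (P : Ideal R)
    (hψ : ∀ r ∈ P, ψ (algebraMap R T r) = 0) :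
    ∃ r ∉ P, r • (LinearMap.id : A →ₗ[R] A) ∈ traceEnd (R := R) N A := by
  -- the formation of modules of homomorphisms commutes with the base change to `T`
  have hE := Module.FinitePresentation.isBaseChange_map R A A T
  have hα := fun b => Module.FinitePresentation.isBaseChange_map R A (N b) T
  have hβ := fun b => Module.FinitePresentation.isBaseChange_map R (N b) A T
  let L : ((T ⊗[R] A) →ₗ[T] (T ⊗[R] A)) →ₗ[T] T ⊗[R] ((A →ₗ[R] A) ⧸ traceEnd N A) :=
    (LinearMap.baseChange T (traceEnd N A).mkQ) ∘ₗ hE.equiv.symm.toLinearMap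
  have hL : ∀ θ : A →ₗ[R] A, L (LinearMap.baseChangeHom R T A A θ) =
      1 ⊗ₜ (traceEnd N A).mkQ θ := by
    intro θ
    change LinearMap.baseChange T (traceEnd N A).mkQ
      (hE.equiv.symm (LinearMap.baseChangeHom R T A A θ)) = _
    rw [hE.equiv_symm_apply, LinearMap.baseChange_tmul]
  have hL' : ∀ θ ∈ traceEnd (R := T) (fun b => T ⊗[R] N b) (T ⊗[R] A), L θ = 0 := by
    intro θ hθ
    refine (Submodule.span_le (p := L.ker)).2 ?_ hθ
    rintro _ ⟨b, α, β, rfl⟩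
    change L (β ∘ₗ α) = 0
    induction α using (hα b).inductionOn with
    | zero => rw [LinearMap.comp_zero, map_zero]
    | smul s α h => rw [LinearMap.comp_smul, map_smul, h, smul_zero]
    | add α α' h h' => rw [LinearMap.comp_add, map_add, h, h', add_zero]
    | tmul α =>
      induction β using (hβ b).inductionOn with
      | zero => rw [LinearMap.zero_comp, map_zero]
      | smul s β h => rw [LinearMap.smul_comp, map_smul, h, smul_zero]
      | add β β' h h' => rw [LinearMap.add_comp, map_add, h, h', add_zero]
      | tmul β =>
        have : LinearMap.baseChangeHom R T (N b) A β ∘ₗ LinearMap.baseChangeHom R T A (N b) α =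
            LinearMap.baseChangeHom R T A A (β ∘ₗ α) := (LinearMap.baseChange_comp _ _).symm
        rw [this, hL, Submodule.mkQ_apply,
          (Submodule.Quotient.mk_eq_zero _).2 (comp_mem_traceEnd b α β), tmul_zero]
  obtain ⟨x, hx⟩ : ∃ x, x = (traceEnd N A).mkQ (LinearMap.id : A →ₗ[R] A) := ⟨_, rfl⟩
  have h0 : (1 : T) ⊗ₜ[R] x = 0 := by
    rw [hx, ← hL, ← hL' _ h]
    congr 1
    exact LinearMap.baseChange_id
  -- by flatness this relation is trivial: `1 = ∑ a j • y j` in `T` with all `a j` annihilating `x`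
  have h0' : ∑ _i : Unit, x ⊗ₜ[R] (1 : T) = 0 := by
    rw [Finset.sum_const, Finset.card_univ, Fintype.card_unit, one_smul,
      ← TensorProduct.comm_tmul R, h0, map_zero]
  obtain ⟨n, a, y, hy, ha⟩ := vanishesTrivially_of_sum_tmul_eq_zero_of_rTensor_injective R
    (Module.Flat.rTensor_preserves_injective_linearMap (M := T)
      (Submodule.span R (Set.range fun _ : Unit => x)).subtype
      (Submodule.subtype_injective _)) h0'
  by_contra! H
  refine one_ne_zero (α := k) ?_
  rw [← map_one ψ, show (1 : T) = ∑ j, a () j • y j from hy (), map_sum]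
  refine Finset.sum_eq_zero fun j _ => ?_
  rw [Algebra.smul_def, map_mul, hψ, zero_mul]
  by_contra hj
  refine H _ hj ((Submodule.Quotient.mk_eq_zero _).1 ?_)
  have := ha j
  rw [Finset.univ_unique, Finset.sum_singleton] at this
  rw [Submodule.Quotient.mk_smul]
  rwa [hx] at this

end TraceEnd

/-! ### Iterated Frobenius pushforwards -/

section FrobeniusPushforward

/-- The `R`-module `F^e_* R` as an unbundled module. The endomorphisms of the underlying module of
`frobeniusPushforward p R e` carry a second `R`-module structure, by precomposition with
multiplications, which instance search prefers to the usual one. -/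
def FrobeniusPushforward (_p : ℕ) (R : Type*) [CommRing R] (_e : ℕ) : Type _ := R

namespace FrobeniusPushforward

variable {p : ℕ} [Fact p.Prime] {R : Type*} [CommRing R] [CharP R p]

instance (e : ℕ) : AddCommGroup (FrobeniusPushforward p R e) := inferInstanceAs (AddCommGroup R)

instance (e : ℕ) : Module R (FrobeniusPushforward p R e) :=
  Module.compHom R (iterateFrobenius R p e)

/-- The identity, as an additive map to `F^e_* R`. -/
def mk (e : ℕ) : R ≃+ FrobeniusPushforward p R e := AddEquiv.refl R

lemma mk_symm_smul (e : ℕ) (r : R) (x : FrobeniusPushforward p R e) :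
    (mk e).symm (r • x) = r ^ p ^ e * (mk e).symm x := rfl

lemma smul_mk (e : ℕ) (r x : R) : r • mk (p := p) e x = mk e (r ^ p ^ e * x) := rfl

end FrobeniusPushforward

variable {p : ℕ} [Fact p.Prime] {R : Type*} [CommRing R] [CharP R p]

/-- Over a ring `R` of finite `F`-representation type there is a bound `n` such that all
`F^e_* R` are direct summands of finite direct sums of modules `F^b_* R` with `b ≤ n`. -/
lemma HasFFRT.exists_id_mem_traceEnd {R : Type u} [CommRing R] [CharP R p]
    (h : HasFFRT p R) : ∃ n : ℕ, ∀ e, LinearMap.id ∈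
    traceEnd (R := R) (fun b : Fin (n + 1) => FrobeniusPushforward p R b)
      (FrobeniusPushforward p R e) := by
  obtain ⟨s, M, -, h⟩ := h
  choose n σ using fun e => show ∃ n : Fin s → ℕ, Nonempty (FrobeniusPushforward p R e ≃ₗ[R]
    ((j : Fin s) → (Fin (n j) → M j))) from h e
  -- for each `j` such that `M j` occurs at all, some exponent where it occurs
  have H : ∀ j, ∃ e₀, ∀ e, n e j ≠ 0 → n e₀ j ≠ 0 := fun j => by
    by_cases hj : ∃ e, n e j ≠ 0
    · exact ⟨hj.choose, fun _ _ => hj.choose_spec⟩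
    · push Not at hj
      exact ⟨0, fun e he => absurd (hj e) he⟩
  choose e₀ he₀ using H
  let incl : ∀ e j, Fin (n e j) → (M j →ₗ[R] FrobeniusPushforward p R e) := fun e j i =>
    (σ e).some.symm.toLinearMap ∘ₗ LinearMap.single R _ j ∘ₗ
      LinearMap.single R (fun _ => M j) i
  let pr : ∀ e j, Fin (n e j) → (FrobeniusPushforward p R e →ₗ[R] M j) := fun e j i =>
    LinearMap.proj i ∘ₗ LinearMap.proj j ∘ₗ (σ e).some.toLinearMap
  have hret : ∀ e j i, pr e j i ∘ₗ incl e j i = LinearMap.id := fun e j i =>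
    LinearMap.ext fun x => by simp [pr, incl]
  have hsum : ∀ e, LinearMap.id = ∑ j, ∑ i, incl e j i ∘ₗ pr e j i := fun e => by
    refine LinearMap.ext fun x => (σ e).some.injective ?_
    have h₁ : ∀ j i, (σ e).some ((incl e j i ∘ₗ pr e j i) x) =
        Pi.single j (Pi.single i ((σ e).some x j i)) := fun j i =>
      (σ e).some.apply_symm_apply _
    simp only [LinearMap.sum_apply, map_sum, h₁, LinearMap.id_apply]
    refine funext fun j => ?_
    rw [Finset.sum_apply, Finset.sum_eq_single j]
    · simp only [Finset.sum_apply, Pi.single_eq_same]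
      exact (Finset.univ_sum_single _).symm
    · intro j' _ hj
      simp only [Finset.sum_apply, Pi.single_eq_of_ne hj.symm, Finset.sum_const_zero]
    · exact fun hj => absurd (Finset.mem_univ j) hj
  refine ⟨Finset.univ.sup e₀, fun e => ?_⟩
  rw [hsum]
  refine Submodule.sum_mem _ fun j _ => Submodule.sum_mem _ fun i _ => ?_
  let i₀ : Fin (n (e₀ j) j) := ⟨0, Nat.pos_of_ne_zero (he₀ j e i.pos.ne')⟩
  have hb : e₀ j < Finset.univ.sup e₀ + 1 :=
    Nat.lt_succ_of_le (Finset.le_sup (f := e₀) (Finset.mem_univ j))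
  have := comp_mem_traceEnd
    (N := fun b : Fin (Finset.univ.sup e₀ + 1) => FrobeniusPushforward p R b) ⟨e₀ j, hb⟩
    (incl (e₀ j) j i₀ ∘ₗ pr e j i) (incl e j i ∘ₗ pr (e₀ j) j i₀)
  rwa [LinearMap.comp_assoc, ← LinearMap.comp_assoc (pr e j i), hret, LinearMap.id_comp] at this

/-- A linear map `F^a_* R → F^b_* R` is also a linear map `F^{a+1}_* R → F^{b+1}_* R`. -/
def frobeniusPushforwardSucc (a b : ℕ) :
    (FrobeniusPushforward p R a →ₗ[R] FrobeniusPushforward p R b) →+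
      (FrobeniusPushforward p R (a + 1) →ₗ[R] FrobeniusPushforward p R (b + 1)) where
  toFun α :=
    { toFun := fun x => .mk (b + 1) ((FrobeniusPushforward.mk b).symm
        (α (.mk a ((FrobeniusPushforward.mk (a + 1)).symm x))))
      map_add' := fun x y => by simp only [map_add]
      map_smul' := fun r x => by
        rw [FrobeniusPushforward.mk_symm_smul, pow_succ', pow_mul, ← FrobeniusPushforward.smul_mk,
          map_smul, FrobeniusPushforward.mk_symm_smul, ← pow_mul, ← pow_succ',
          ← FrobeniusPushforward.smul_mk, RingHom.id_apply] }
  map_zero' := rfl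
  map_add' _ _ := rfl

lemma frobeniusPushforwardSucc_pow_smul (a b : ℕ) (r : R)
    (α : FrobeniusPushforward p R a →ₗ[R] FrobeniusPushforward p R b) :
    frobeniusPushforwardSucc a b (r ^ p • α) = r • frobeniusPushforwardSucc a b α := by
  refine LinearMap.ext fun x => (FrobeniusPushforward.mk (b + 1)).symm.injective ?_
  rw [LinearMap.smul_apply, FrobeniusPushforward.mk_symm_smul, pow_succ', pow_mul]
  rfl

/-- The functor `F_*` maps direct summands of sums of modules `F^b_* R` with `b ≤ n` to direct
summands of sums of modules `F^b_* R` with `b ≤ n + 1`; this is the version for endomorphisms. -/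
lemma frobeniusPushforwardSucc_mem_traceEnd {n e : ℕ}
    {θ : FrobeniusPushforward p R e →ₗ[R] FrobeniusPushforward p R e}
    (hθ : θ ∈ traceEnd (R := R) (fun b : Fin (n + 1) => FrobeniusPushforward p R b)
      (FrobeniusPushforward p R e)) :
    frobeniusPushforwardSucc e e θ ∈
      traceEnd (R := R) (fun b : Fin (n + 2) => FrobeniusPushforward p R b)
        (FrobeniusPushforward p R (e + 1)) := by
  -- `frobeniusPushforwardSucc` is only semilinear, so scalars are absorbed before it is applied
  suffices H : ∀ r : R, frobeniusPushforwardSucc e e (r • θ) ∈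
      traceEnd (R := R) (fun b : Fin (n + 2) => FrobeniusPushforward p R b)
        (FrobeniusPushforward p R (e + 1)) by
    have := H 1
    rwa [one_smul] at this
  induction hθ using Submodule.span_induction with
  | mem θ hθ =>
    intro r
    obtain ⟨b, α, β, rfl⟩ := hθ
    exact comp_mem_traceEnd (N := fun b : Fin (n + 2) => FrobeniusPushforward p R b) b.succ
      (frobeniusPushforwardSucc e b α) (frobeniusPushforwardSucc b e (r • β))
  | zero => intro r; rw [smul_zero, map_zero]; exact zero_mem _
  | add θ θ' _ _ h h' => intro r; rw [smul_add, map_add]; exact add_mem (h r) (h' r)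
  | smul a θ _ h => intro r; rw [smul_smul]; exact h _

/-- If, locally on `Spec R`, some `F^{n+1}_* R` is a direct summand of a finite direct sum of modules
`F^b_* R` with `b ≤ n`, then there is a bound `n` such that all `F^e_* R` are direct summands of
finite direct sums of modules `F^b_* R` with `b ≤ n`. -/
lemma exists_forall_id_mem_traceEnd [IsNoetherianRing R]
    (h : ∀ P : Ideal R, P.IsPrime → ∃ n, ∃ r ∉ P, r • LinearMap.id ∈
      traceEnd (R := R) (fun b : Fin (n + 1) => FrobeniusPushforward p R b)
        (FrobeniusPushforward p R (n + 1))) :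
    ∃ n : ℕ, ∀ e, LinearMap.id ∈
      traceEnd (R := R) (fun b : Fin (n + 1) => FrobeniusPushforward p R b)
        (FrobeniusPushforward p R e) := by
  let J : ℕ → Ideal R := fun n =>
    (traceEnd (R := R) (fun b : Fin (n + 1) => FrobeniusPushforward p R b)
        (FrobeniusPushforward p R (n + 1))).comap (LinearMap.toSpanSingleton R _ LinearMap.id)
  -- `J n` consists of the `r` such that `r` times the identity of `F^(n+1)_* R` factors through a
  -- direct sum of modules `F^b_* R` with `b ≤ n`
  have hJ : ∀ n r, r ∈ J n ↔ r • LinearMap.id ∈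
      traceEnd (R := R) (fun b : Fin (n + 1) => FrobeniusPushforward p R b)
        (FrobeniusPushforward p R (n + 1)) := fun _ _ => Iff.rfl
  have hmono : Monotone J := monotone_nat_of_le_succ fun n r hr => by
    have h₁ : r ^ p ∈ J n := Ideal.pow_mem_of_mem _ hr _ (Fact.out : p.Prime).pos
    have h₂ := frobeniusPushforwardSucc_mem_traceEnd ((hJ n _).1 h₁)
    rw [frobeniusPushforwardSucc_pow_smul] at h₂
    exact h₂
  obtain ⟨n, hn⟩ := monotone_stabilizes_iff_noetherian.2 ‹IsNoetherianRing R› ⟨J, hmono⟩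
  have htop : J n = ⊤ := by
    by_contra hne
    obtain ⟨m, hm, hle⟩ := Ideal.exists_le_maximal _ hne
    obtain ⟨k, r, hr, hk⟩ := h m hm.isPrime
    have h₁ : J n = J (max n k) := hn (max n k) (le_max_left _ _)
    exact hr (hle (h₁ ▸ hmono (le_max_right n k) hk))
  have hid : ∀ m, n ≤ m → LinearMap.id ∈
      traceEnd (R := R) (fun b : Fin (m + 1) => FrobeniusPushforward p R b)
        (FrobeniusPushforward p R (m + 1)) := fun m hm => by
    have : (1 : R) ∈ J m := hmono hm (htop ▸ Submodule.mem_top)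
    rwa [hJ, one_smul] at this
  refine ⟨n, fun e => ?_⟩
  induction e using Nat.strong_induction_on with
  | _ e ih =>
    rcases Nat.lt_or_ge e (n + 1) with he | he
    · exact id_mem_traceEnd_self (N := fun b : Fin (n + 1) => FrobeniusPushforward p R b) ⟨e, he⟩
    · obtain ⟨m, rfl⟩ : ∃ m, e = m + 1 := ⟨e - 1, by omega⟩
      exact id_mem_traceEnd_trans (fun b : Fin (m + 1) => ih b b.2) (hid m (by omega))

end FrobeniusPushforward

/-! ### Base change of Frobenius pushforwards -/

namespace FrobeniusPushforward

open TensorProduct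

variable {p : ℕ} [Fact p.Prime] {R : Type*} [CommRing R] [CharP R p] (e : ℕ)

/-- `F^e_*` commutes with localization: inverting `w` or `w ^ p ^ e` amounts to the same. -/
lemma nonempty_equiv_of_isLocalization (W : Submonoid R) (S : Type*) [CommRing S] [CharP S p]
    [Algebra R S] [IsLocalization W S] :
    Nonempty (S ⊗[R] FrobeniusPushforward p R e ≃ₗ[S] FrobeniusPushforward p S e) := by
  let _ : Module R (FrobeniusPushforward p S e) :=
    Module.compHom (FrobeniusPushforward p S e) (algebraMap R S)
  have : IsScalarTower R S (FrobeniusPushforward p S e) := IsScalarTower.of_algebraMap_smul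
    fun _ _ => rfl
  have hsmul : ∀ (r : R) (x : S), r • mk (p := p) e x = mk e (algebraMap R S r ^ p ^ e * x) :=
    fun r x => smul_mk e _ x
  have hq : 1 ≤ p ^ e := Nat.one_le_pow _ _ (Fact.out : p.Prime).pos
  let φ : FrobeniusPushforward p R e →ₗ[R] FrobeniusPushforward p S e :=
    { toFun := fun x => mk e (algebraMap R S ((mk e).symm x))
      map_add' := fun x y => by simp only [map_add]
      map_smul' := fun r x => by
        rw [mk_symm_smul, map_mul, map_pow, RingHom.id_apply, hsmul] }
  have hφ : ∀ x, φ (mk e x) = mk e (algebraMap R S x) := fun _ => rfl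
  have : IsLocalizedModule W φ :=
    { map_units := fun w => by
        rw [Module.End.isUnit_iff]
        have h : IsUnit (algebraMap R S w ^ p ^ e) := (IsLocalization.map_units S w).pow _
        exact IsUnit.isUnit_iff_mulLeft_bijective (a := algebraMap R S w ^ p ^ e).1 h
      surj := fun y => by
        obtain ⟨y, rfl⟩ := (mk e).surjective y
        obtain ⟨⟨x, w⟩, h⟩ := IsLocalization.surj W y
        refine ⟨⟨mk e (w ^ (p ^ e - 1) * x), w⟩, ?_⟩
        change (w : R) • mk (p := p) e y = φ (mk e ((w : R) ^ (p ^ e - 1) * x))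
        rw [hsmul, hφ]
        refine congrArg (mk e) ?_
        rw [map_mul, ← h, map_pow, mul_left_comm, ← pow_succ, Nat.sub_add_cancel hq, mul_comm]
      exists_of_eq := fun {x y} h => by
        obtain ⟨x, rfl⟩ := (mk e).surjective x
        obtain ⟨y, rfl⟩ := (mk e).surjective y
        obtain ⟨w, hw⟩ := IsLocalization.exists_of_eq (M := W) (S := S) (x := x) (y := y)
          ((mk e).injective h)
        refine ⟨w, ?_⟩
        change (w : R) • mk (p := p) e x = (w : R) • mk (p := p) e y
        rw [smul_mk, smul_mk, ← Nat.sub_add_cancel hq, pow_succ, mul_assoc, mul_assoc, hw] }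
  exact ⟨((isLocalizedModule_iff_isBaseChange W S φ).1 this).equiv⟩

section AdicCompletion

variable (I : Ideal R)

/-- The identity of `R`, as a semilinear map from `F^e_* R` to `R`. -/
def toSelf : FrobeniusPushforward p R e →ₛₗ[iterateFrobenius R p e] R where
  toFun := (mk e).symm
  map_add' := map_add _
  map_smul' _ _ := rfl

lemma smul_top_le_comap_toSelf (n : ℕ) :
    (I ^ n • ⊤ : Submodule R (FrobeniusPushforward p R e)) ≤
      (I ^ n • ⊤ : Submodule R R).comap (toSelf e) := by
  refine Submodule.smul_le.2 fun r hr x _ => ?_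
  change r ^ p ^ e * (mk e).symm x ∈ (I ^ n • ⊤ : Ideal R)
  rw [smul_eq_mul, Ideal.mul_top]
  exact Ideal.mul_mem_right _ _
    (Ideal.pow_mem_of_mem _ hr _ (pow_pos (Fact.out : p.Prime).pos _))

/-- The topologies on `R` that are given by the powers of `I` and by their Frobenius powers
agree. -/
lemma exists_pow_le_smul_top [IsNoetherianRing R] (n : ℕ) : ∃ N, ∀ x ∈ I ^ N,
    mk e x ∈ (I ^ n • ⊤ : Submodule R (FrobeniusPushforward p R e)) := by
  let J : Ideal R := Ideal.span ((fun r => r ^ p ^ e) '' (I ^ n : Ideal R))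
  obtain ⟨N, hN⟩ := Ideal.exists_radical_pow_le_of_fg J (IsNoetherian.noetherian _)
  have hI : I ^ n ≤ J.radical := fun r hr => ⟨p ^ e, Ideal.subset_span ⟨r, hr, rfl⟩⟩
  refine ⟨n * N, fun x hx => ?_⟩
  replace hx : x ∈ J := hN (Ideal.pow_right_mono hI N (by rwa [← pow_mul]))
  suffices H : ∀ a, mk e (a * x) ∈ (I ^ n • ⊤ : Submodule R (FrobeniusPushforward p R e)) by
    have := H 1
    rwa [one_mul] at this
  induction hx using Submodule.span_induction with
  | mem x hx =>
    intro a
    obtain ⟨r, hr, rfl⟩ := hx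
    have := Submodule.smul_mem_smul hr (Submodule.mem_top (x := mk (p := p) e a))
    rwa [smul_mk, mul_comm] at this
  | zero => intro a; rw [mul_zero, map_zero]; exact zero_mem _
  | add x y _ _ hx hy => intro a; rw [mul_add, map_add]; exact add_mem (hx a) (hy a)
  | smul b x _ h => intro a; rw [smul_eq_mul, ← mul_assoc]; exact h _

/-- The map `F^e_* R / I^n F^e_* R → R / I^n` that is induced by the identity of `R`. -/
noncomputable def quotientToSelf (n : ℕ) :
    (FrobeniusPushforward p R e ⧸ (I ^ n • ⊤ : Submodule R (FrobeniusPushforward p R e))) →ₛₗ[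
      iterateFrobenius R p e] R ⧸ (I ^ n • ⊤ : Submodule R R) :=
  Submodule.mapQ _ _ (toSelf e) (smul_top_le_comap_toSelf e I n)

lemma quotientToSelf_mk (n : ℕ) (x : R) :
    quotientToSelf (p := p) e I n (Submodule.Quotient.mk (mk e x)) = Submodule.Quotient.mk x := rfl

variable {I} in
lemma mk_eq_val_of_le {M : Type*} [AddCommGroup M] [Module R M] {x : AdicCompletion I M} {m n : ℕ}
    (hmn : m ≤ n) {y : M} (hy : Submodule.Quotient.mk y = x.val n) :
    Submodule.Quotient.mk y = x.val m := by
  exact (congrArg (AdicCompletion.transitionMap I M hmn) hy).trans (x.2 hmn)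

lemma transitionMap_quotientToSelf {m n : ℕ} (hmn : m ≤ n)
    (z : FrobeniusPushforward p R e ⧸
      (I ^ n • ⊤ : Submodule R (FrobeniusPushforward p R e))) :
    AdicCompletion.transitionMap I R hmn (quotientToSelf e I n z) =
      quotientToSelf e I m (AdicCompletion.transitionMap I _ hmn z) := by
  obtain ⟨y, rfl⟩ := Submodule.Quotient.mk_surjective _ z
  obtain ⟨y, rfl⟩ := (mk e).surjective y
  have h₁ : AdicCompletion.transitionMap I (FrobeniusPushforward p R e) hmn
    (Submodule.Quotient.mk (mk e y)) = Submodule.Quotient.mk (mk e y) := Submodule.mapQ_apply _ _ _ _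
  have h₂ : AdicCompletion.transitionMap I R hmn
    (Submodule.Quotient.mk y) = Submodule.Quotient.mk y := Submodule.mapQ_apply _ _ _ _
  rw [h₁, quotientToSelf_mk, quotientToSelf_mk, h₂]

/-- The map from the completion of `F^e_* R` to the completion of `R` that is induced by the
identity of `R`. -/
noncomputable def completionToSelf (x : AdicCompletion I (FrobeniusPushforward p R e)) :
    AdicCompletion I R :=
  ⟨fun n => quotientToSelf e I n (x.val n), fun {m n} hmn => by
    rw [transitionMap_quotientToSelf, AdicCompletion.transitionMap_comp_eval_apply]⟩

lemma val_completionToSelf (x : AdicCompletion I (FrobeniusPushforward p R e)) (n : ℕ) :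
    (completionToSelf e I x).val n = quotientToSelf e I n (x.val n) := rfl

lemma completionToSelf_add (x y : AdicCompletion I (FrobeniusPushforward p R e)) :
    completionToSelf e I (x + y) = completionToSelf e I x + completionToSelf e I y := by
  refine AdicCompletion.ext fun n => ?_
  rw [AdicCompletion.val_add_apply, val_completionToSelf, val_completionToSelf,
    val_completionToSelf, AdicCompletion.val_add_apply, map_add]

lemma quotientToSelf_mk_smul (n : ℕ) (r : R ⧸ (I ^ n • ⊤ : Ideal R))
    (x : FrobeniusPushforward p R e ⧸
      (I ^ n • ⊤ : Submodule R (FrobeniusPushforward p R e))) :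
    quotientToSelf e I n (r • x) = r ^ p ^ e * quotientToSelf e I n x := by
  obtain ⟨r, rfl⟩ := Ideal.Quotient.mk_surjective r
  obtain ⟨x, rfl⟩ := Submodule.Quotient.mk_surjective _ x
  rfl

lemma completionToSelf_smul (t : AdicCompletion I R)
    (x : AdicCompletion I (FrobeniusPushforward p R e)) :
    completionToSelf e I (t • x) = t ^ p ^ e * completionToSelf e I x := by
  refine AdicCompletion.ext fun n => ?_
  have h : ∀ k : ℕ, (t ^ k).val n = t.val n ^ k := fun k => by
    induction k with
    | zero => rw [pow_zero, pow_zero, AdicCompletion.val_one]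
    | succ k ih => rw [pow_succ, pow_succ, AdicCompletion.val_mul, ih]
  rw [AdicCompletion.val_mul, val_completionToSelf, val_completionToSelf,
    AdicCompletion.smul_eval, quotientToSelf_mk_smul, h]

/-- The quotients of `R` by `I ^ n` and by its Frobenius powers form cofinal systems. -/
lemma completionToSelf_bijective [IsNoetherianRing R] :
    Function.Bijective (completionToSelf (p := p) e I) := by
  choose N hN using exists_pow_le_smul_top (p := p) e I
  constructor
  · refine (injective_iff_map_eq_zero
      (⟨⟨completionToSelf (p := p) e I, ?_⟩, completionToSelf_add e I⟩ :
        AdicCompletion I (FrobeniusPushforward p R e) →+ AdicCompletion I R)).2 fun x hx => ?_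
    · refine AdicCompletion.ext fun n => ?_
      rw [val_completionToSelf, AdicCompletion.val_zero_apply, AdicCompletion.val_zero_apply,
        map_zero]
    refine AdicCompletion.ext fun n => ?_
    obtain ⟨y, hy⟩ := Submodule.Quotient.mk_surjective _ (x.val (max n (N n)))
    have h : quotientToSelf e I (max n (N n)) (x.val (max n (N n))) = 0 :=
      congrArg (fun t : AdicCompletion I R => t.val (max n (N n))) hx
    rw [← hy] at h
    have h' : (mk e).symm y ∈ I ^ max n (N n) := by
      have := (Submodule.Quotient.mk_eq_zero _).1 h
      rwa [smul_eq_mul, Ideal.mul_top] at this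
    rw [← mk_eq_val_of_le (le_max_left n (N n)) hy]
    exact (Submodule.Quotient.mk_eq_zero _).2
      (hN n _ (Ideal.pow_le_pow_right (le_max_right n (N n)) h'))
  · intro t
    choose s hs using fun n => Submodule.Quotient.mk_surjective _ (t.val n)
    -- a monotone choice of exponents with `I ^ K n ⊆ I ^ n F^e_* R` and `n ≤ K n`
    let K : ℕ → ℕ := fun n => n + (Finset.range (n + 1)).sup N
    have hK : Monotone K := fun m n hmn =>
      add_le_add hmn (Finset.sup_mono (Finset.range_subset_range.2 (by omega)))
    have hNK : ∀ n, N n ≤ K n := fun n =>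
      le_add_left (Finset.le_sup (f := N) (Finset.mem_range.2 n.lt_succ_self))
    refine ⟨⟨fun n => Submodule.Quotient.mk (mk e (s (K n))), fun {m n} hmn => ?_⟩, ?_⟩
    · refine (Submodule.Quotient.eq _).2 ?_
      change mk e (s (K n)) - mk e (s (K m)) ∈ _
      rw [← map_sub]
      refine hN m _ (Ideal.pow_le_pow_right (hNK m) ?_)
      have := (Submodule.Quotient.eq _).1 ((mk_eq_val_of_le (hK hmn) (hs (K n))).trans (hs (K m)).symm)
      rwa [smul_eq_mul, Ideal.mul_top] at this
    · refine AdicCompletion.ext fun n => ?_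
      exact mk_eq_val_of_le (Nat.le_add_right n _) (hs (K n))

/-- `F^e_*` commutes with completion. -/
noncomputable def adicCompletionEquiv [IsNoetherianRing R] [CharP (AdicCompletion I R) p] :
    AdicCompletion I (FrobeniusPushforward p R e) ≃ₗ[AdicCompletion I R]
      FrobeniusPushforward p (AdicCompletion I R) e :=
  LinearEquiv.ofBijective
    { toFun := fun x => mk e (completionToSelf e I x)
      map_add' := fun x y => by rw [completionToSelf_add, map_add]
      map_smul' := fun t x => by rw [completionToSelf_smul, RingHom.id_apply, smul_mk] }
    ((mk e).bijective.comp (completionToSelf_bijective e I))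

lemma nonempty_equiv_of_adicCompletion {R : Type u} [CommRing R] [CharP R p] (I : Ideal R)
    [CharP (AdicCompletion I R) p] [IsNoetherianRing R]
    [Module.Finite R (FrobeniusPushforward p R e)] :
    Nonempty (AdicCompletion I R ⊗[R] FrobeniusPushforward p R e ≃ₗ[AdicCompletion I R]
      FrobeniusPushforward p (AdicCompletion I R) e) :=
  ⟨AdicCompletion.ofTensorProductEquivOfFiniteNoetherian I (FrobeniusPushforward p R e) ≪≫ₗ
    adicCompletionEquiv e I⟩

end AdicCompletion

end FrobeniusPushforward

section CLFFRT

open TensorProduct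

variable {p : ℕ} [Fact p.Prime] {R : Type u} [CommRing R] [CharP R p]

lemma IsFFinite.finite_frobeniusPushforward (h : IsFFinite p R) (e : ℕ) :
    Module.Finite R (FrobeniusPushforward p R e) := by
  suffices H : (iterateFrobenius R p e).Finite from H
  induction e with
  | zero =>
    rw [iterateFrobenius_zero]
    exact RingHom.Finite.id R
  | succ e ih =>
    have : iterateFrobenius R p (e + 1) = (iterateFrobenius R p e).comp (frobenius R p) := by
      ext x
      rw [RingHom.comp_apply, iterateFrobenius_def, iterateFrobenius_def, frobenius_def, pow_succ',
        pow_mul]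
    rw [this]
    exact ih.comp h.finite_frobenius

instance Localization.AtPrime.charP (P : Ideal R) [P.IsPrime] :
    CharP (Localization.AtPrime P) p := by
  refine (CharP.charP_iff_prime_eq_zero Fact.out).2 ?_
  rw [← map_natCast (algebraMap R (Localization.AtPrime P)), CharP.cast_eq_zero, map_zero]

/-- Complete local finite `F`-representation type implies that there is a bound `n` such that all
`F^e_* R` are direct summands of finite direct sums of modules `F^b_* R` with `b ≤ n`. -/
lemma HasCLFFRT.exists_id_mem_traceEnd (h : HasCLFFRT p R) : ∃ n : ℕ, ∀ e, LinearMap.id ∈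
    traceEnd (R := R) (fun b : Fin (n + 1) => FrobeniusPushforward p R b)
      (FrobeniusPushforward p R e) := by
  have hR := h.isFFinite.isNoetherianRing
  have hfin := h.isFFinite.finite_frobeniusPushforward
  have hfp : ∀ e, Module.FinitePresentation R (FrobeniusPushforward p R e) := fun e =>
    Module.finitePresentation_of_finite R _
  refine exists_forall_id_mem_traceEnd fun P hP => ?_
  let S := Localization.AtPrime P
  let m := IsLocalRing.maximalIdeal S
  let T := CompletedLocalRing P
  have : IsScalarTower R S T := IsScalarTower.of_algebraMap_eq fun _ => rfl
  have : IsNoetherianRing S := IsLocalization.isNoetherianRing P.primeCompl S hR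
  have : Module.Flat R S := IsLocalization.flat S P.primeCompl
  have : Module.Flat S T := AdicCompletion.flat_of_isNoetherian m
  have : Module.Flat R T := Module.Flat.trans R S T
  have hS := fun e => FrobeniusPushforward.nonempty_equiv_of_isLocalization (p := p) (R := R) e
    P.primeCompl S
  have hfinS : ∀ e, Module.Finite S (FrobeniusPushforward p S e) := fun e =>
    Module.Finite.equiv (hS e).some
  have hT := fun e => FrobeniusPushforward.nonempty_equiv_of_adicCompletion (p := p) e m
  let σ : ∀ e, FrobeniusPushforward p T e ≃ₗ[T] T ⊗[R] FrobeniusPushforward p R e := fun e =>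
    (hT e).some.symm ≪≫ₗ (AlgebraTensorModule.congr (LinearEquiv.refl T T) (hS e).some.symm ≪≫ₗ
      AlgebraTensorModule.cancelBaseChange R S T T _)
  obtain ⟨n, hn⟩ := (h.hasFFRT P).exists_id_mem_traceEnd
  refine ⟨n, exists_smul_id_mem_traceEnd_of_flat T
    (id_mem_traceEnd_of_linearEquiv (fun b : Fin (n + 1) => σ b) (σ (n + 1)) (hn (n + 1)))
    (AdicCompletion.evalOneₐ m).toRingHom P fun r hr => ?_⟩
  exact Ideal.Quotient.eq_zero_iff_mem.2
    ((IsLocalization.AtPrime.to_map_mem_maximal_iff S P r).2 hr)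

end CLFFRT

/-! ### Closedness of the support -/

section

variable {R : Type u} [CommRing R] {ι : Type} [Finite ι] {f : ι → R} {g : R} {k : ℕ}
  {M : ModuleCat.{u} R} [IsNoetherian R M]

lemma Cech.finite_source₁ : Module.Finite R (source₁ f k M) := by
  have := isNoetherian_bounded (f := f) 1 k M
  have := isNoetherian_of_le (inf_le_right : source₁ f k M ≤ bounded f 1 k M)
  exact @Module.IsNoetherian.finite R _ _ _ _ this

lemma Cech.finite_source₂ : Module.Finite R (source₂ f g k M) := by
  have := isNoetherian_bounded (f := f) 1 k M
  have := isNoetherian_of_le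
    (inf_le_left.trans inf_le_right : source₂ f g k M ≤ bounded f 1 k M)
  exact @Module.IsNoetherian.finite R _ _ _ _ this

end

theorem mainTheorem2 (p : ℕ) [Fact p.Prime] (R : Type u) [CommRing R] [CharP R p]
    (hR : HasCLFFRT p R) (g : R) (hg : g ∈ nonZeroDivisors R) (I : Ideal R) (i : ℕ) :
    IsClosed (Module.support R
      ((localCohomology I i).obj (ModuleCat.of R (R ⧸ Ideal.span {g})))) := by
  have hnoeth := hR.isFFinite.isNoetherianRing
  obtain ⟨m, f, hf⟩ := Submodule.fg_iff_exists_fin_generating_family.1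
    (IsNoetherian.noetherian (R := R) I)
  obtain rfl : Ideal.span (Set.range f) = I := hf
  obtain ⟨n, hn⟩ := hR.exists_id_mem_traceEnd
  let A : ℕ → ModuleCat.{u} R := fun e => frobeniusPushforward p R e
  have hA : ∀ e, IsNoetherian R (A e) := fun e =>
    have := hR.isFFinite.finite_frobeniusPushforward e
    isNoetherian_of_isNoetherianRing_of_finite R (FrobeniusPushforward p R e)
  have hF : ∀ e (a : R), iterateFrobenius R p e a = a ^ p ^ e := fun e a =>
    iterateFrobenius_def p e a
  have hq : ∀ e, p ^ e ≠ 0 := fun e => pow_ne_zero _ (Fact.out : p.Prime).ne_zero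
  have hinj : Function.Injective fun a : R => g • a := fun a b hab =>
    (mul_cancel_left_mem_nonZeroDivisors hg).1 hab
  have hexact : Function.Exact (g • LinearMap.id : R →ₗ[R] R) (Ideal.span {g}).mkQ := fun a => by
    rw [Submodule.mkQ_apply, Submodule.Quotient.mk_eq_zero, Ideal.mem_span_singleton]
    exact ⟨fun ⟨b, hb⟩ => ⟨b, hb.symm⟩, fun ⟨b, hb⟩ => ⟨b, hb.symm⟩⟩
  have hcompl : (Module.support R ((localCohomology (Ideal.span (Set.range f)) i).obj
        (ModuleCat.of R (R ⧸ Ideal.span {g}))))ᶜ =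
      ⋂ b : Fin (n + 1),
        ({P : PrimeSpectrum R | ∀ u ∈ Cech.source₁ f i (A b),
            ∃ s ∈ P.asIdeal.primeCompl, s • u ∈ Cech.target₁ f g i (A b)} ∩
          {P : PrimeSpectrum R | ∀ u ∈ Cech.source₂ f g (i + 1) (A b),
            ∃ s ∈ P.asIdeal.primeCompl, s • u ∈ Cech.coboundaries f (i + 1) (A b)}) := by
    ext P
    have h₁ := LocalCohomologyRep.forall_exists_smul_eq_zero_iff (I := Ideal.span (Set.range f))
      P.asIdeal.primeCompl i (ModuleCat.of R (R ⧸ Ideal.span {g}))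
    have h₂ := Cech.vanishExt_iff_vanish (f := f) P.asIdeal.primeCompl i
      (ModuleCat.of R (R ⧸ Ideal.span {g}))
    have h₃ := Cech.vanish_iff_of_exact (f := f) (g := g) (k := i) (M := ModuleCat.of R R)
      (Q := ModuleCat.of R (R ⧸ Ideal.span {g})) P.asIdeal.primeCompl
      (Ideal.span {g}).mkQ hinj (Submodule.mkQ_surjective _) hexact
    -- outside of the support, `g` acts surjectively in degree `i` and injectively in degree `i + 1`
    rw [Set.mem_compl_iff, Module.notMem_support_iff', Set.mem_iInter]
    refine (h₁.trans (h₂.trans h₃)).trans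
      ⟨fun H b => ⟨?_, ?_⟩, fun H => ⟨fun z hz => ?_, fun z hz hgz => ?_⟩⟩
    · exact Cech.exists_smul_mem_target₁_restrict (hF b) (hq b) _ H.1
    · exact Cech.exists_smul_mem_coboundaries_restrict (hF b) (hq b) _ H.2
    -- a cocycle on `R` comes from one with denominators `f j` on some `F^e_* R`, which is a direct
    -- summand of a sum of the modules `A b`
    · obtain ⟨e, he⟩ := Cech.exists_mem_bounded i z
      have hb := Cech.bounded_mono (Nat.lt_pow_self (Fact.out : p.Prime).one_lt).le i _ he
      refine Cech.exists_smul_mem_target₁_of_restrict (hF e) (hq e) _ ?_ hz hb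
      exact Cech.exists_smul_mem_of_traceEnd (N := fun b : Fin (n + 1) => A b) (A := A e) (hn e)
        (fun M => Cech.source₁ f i M) (fun M => Cech.target₁ f g i M) Cech.map_mem_source₁
        Cech.map_mem_target₁ _ fun b => (H b).1
    · obtain ⟨e, he⟩ := Cech.exists_mem_bounded (i + 1) z
      have hb := Cech.bounded_mono (Nat.lt_pow_self (Fact.out : p.Prime).one_lt).le (i + 1) _ he
      refine Cech.exists_smul_mem_coboundaries_of_restrict (hF e) (hq e) _ ?_ hz hb hgz
      exact Cech.exists_smul_mem_of_traceEnd (N := fun b : Fin (n + 1) => A b) (A := A e) (hn e)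
        (fun M => Cech.source₂ f g (i + 1) M) (fun M => Cech.coboundaries f (i + 1) M)
        Cech.map_mem_source₂ Cech.map_mem_coboundaries _ fun b => (H b).2
  rw [← isOpen_compl_iff, hcompl]
  refine isOpen_iInter_of_finite fun b => IsOpen.inter ?_ ?_
  · have := Cech.finite_source₁ (f := f) (k := i) (M := A b)
    exact PrimeSpectrum.isOpen_forall_exists_smul_mem _ _
  · have := Cech.finite_source₂ (f := f) (g := g) (k := i + 1) (M := A b)
    exact PrimeSpectrum.isOpen_forall_exists_smul_mem _ _
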